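/- Let $S$ be an unknown subset of a known finite universe $U$, and let $\mathcal F$ be a family of subsets of $U$. A \emph{subset sample} on $T\in\mathcal F$ returns a uniformly distributed element of $T\cap S$, or reports that $T\cap S=\emptyset$. A \emph{set size approximation algorithm} over $\mathcal F$ is an adaptive randomized algorithm that is given $\epsilon\in(0,1]$, accesses $S$ only by subset samples on members of $\mathcal F$, and for every $S\subseteq U$ returns an estimate $\widehat w$ such that $\frac{1}{1+\epsilon}|S|\le\widehat w\le(1+\epsilon)|S|$ with probability at least $2/3$. Put $$g(w,\epsilon)=\frac{\log^4(w+2)\cdot\log\bigl(\log(w+2)+2\bigr)}{\epsilon^2}.$$ For $c>0$ and $R\in\mathcal F$, a \emph{$c$-balanced part} of $R$ is a set $R'\in\mathcal F$ with $R'\subsetneq R$ and $c\,|R\cap S|\le|R'\cap S|\le(1-c)\,|R\cap S|$. \textbf{Grids.} Let $d\ge1$ be a constant. For $k\ge1$ let $U=\{1,\dots,k\}^d$ and let $\mathcal F$ consist of all sub-grids $\prod_{i=1}^d\{a_i,a_i+1,\dots,b_i\}$ with $1\le a_i\le b_i\le k$. (1) For all $k$ and $S$, every sub-grid $R$ with $|R\cap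 S|\ge2$ has a $c$-balanced part with $c=\frac1{2d}$ if $d\ge2$, and with $c=\frac13$ if $d=1$. (2) There are constants $c>0$ and $C$ that depend only on $d$ such that for all $k$, every sub-grid $R$ and every $\delta\in(0,1)$ there is an algorithm that uses at most $C\log(2/\delta)$ subset samples, all on $R$, and, whenever $|R\cap S|\ge2$, returns a $c$-balanced part of $R$ with probability at least $1-\delta$. (3) There is a constant $C$ that depends only on $d$ such that for all $k$ there is a set size approximation algorithm over $\mathcal F$ for which, for all $\epsilon\in(0,1]$, all $S$ and all $m\in\mathbb N$, the probability that it uses more than $m\cdot C\,g(|S|,\epsilon)$ subset samples is at most $e^{-m}$. \textbf{Boolean hypercube.} Let $U=\{0,1\}^d$ and let $\mathcal F$ consist of all sub-cubes (the sets obtained by fixing the values of a subset of the coordinates). Then (1) holds for all $d\ge 0$ with $c=\frac13$, and (2) and (3) hold with constants $c>0$ and $C$ that do not depend on $d$. -/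

import Mathlib

/-- An adaptive randomized algorithm that accesses a hidden set `S ⊆ U` by subset samples on
members of the family `F` and returns an element of `O`: it stops with an output, or asks for a
subset sample on some `T ∈ F` and continues according to the answer, or tosses a fair coin. -/
inductive SamplingAlg {U : Type} (F : Set (Finset U)) (O : Type) : Type
  | done (out : O) : SamplingAlg F O
  | sample (T : Finset U) (hT : T ∈ F) (next : Option U → SamplingAlg F O) : SamplingAlg F O
  | coin (next : Bool → SamplingAlg F O) : SamplingAlg F O

open Classical in
/-- The answer to a subset sample on `T`: a uniformly distributed element of `T ∩ S`,
or `none` if `T ∩ S` is empty. -/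
noncomputable def subsetSample {U : Type} (S T : Finset U) : PMF (Option U) :=
  if h : (T ∩ S).Nonempty then (PMF.uniformOfFinset (T ∩ S) h).map some else PMF.pure none

/-- The joint law of the output and of the number of subset samples used, on hidden set `S`.
All samples and coin tosses are independent. -/
noncomputable def SamplingAlg.run {U : Type} {F : Set (Finset U)} {O : Type} (S : Finset U) :
    SamplingAlg F O → PMF (O × ℕ)
  | .done out => PMF.pure (out, 0)
  | .sample T _ next =>
      (subsetSample S T).bind fun a => ((next a).run S).map fun x => (x.1, x.2 + 1)
  | .coin next => (PMF.uniformOfFintype Bool).bind fun b => (next b).run S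

/-- The probability of the event `E` under `p`. -/
noncomputable def probOf {α : Type} (p : PMF α) (E : α → Prop) : ℝ :=
  (p.toOuterMeasure {x | E x}).toReal

/-- `A` (which is given `ε`) is a set size approximation algorithm. -/
def IsSetSizeApprox {U : Type} {F : Set (Finset U)} (A : ℝ → SamplingAlg F ℝ) : Prop :=
  ∀ ε : ℝ, 0 < ε → ε ≤ 1 → ∀ S : Finset U,
    2 / 3 ≤ probOf ((A ε).run S)
      (fun x => 1 / (1 + ε) * (S.card : ℝ) ≤ x.1 ∧ x.1 ≤ (1 + ε) * (S.card : ℝ))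

/-- `A` uses `g w ε` samples, where `w` is the size of the hidden set: the probability
that it uses more than `m` times this number is at most `exp (-m)`. -/
def UsesSamples {U : Type} {F : Set (Finset U)} (A : ℝ → SamplingAlg F ℝ)
    (g : ℕ → ℝ → ℝ) : Prop :=
  ∀ ε : ℝ, 0 < ε → ε ≤ 1 → ∀ S : Finset U, ∀ m : ℕ,
    probOf ((A ε).run S) (fun x => (m : ℝ) * g S.card ε < (x.2 : ℝ)) ≤ Real.exp (-(m : ℝ))

/-- The function `log⁴ w · log log w / ε²`, with shifts that keep it positive for all `w ≥ 0`. -/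
noncomputable def polylogBound (w : ℕ) (ε : ℝ) : ℝ :=
  Real.log ((w : ℝ) + 2) ^ 4 * Real.log (Real.log ((w : ℝ) + 2) + 2) / ε ^ 2

open Classical in
/-- `R'` is a proper part of `R`, in the family `F`, that contains at least a fraction `c` and at
most a fraction `1 - c` of the points of `R ∩ S`. -/
def IsBalancedPart {U : Type} (F : Set (Finset U)) (c : ℝ) (S R R' : Finset U) : Prop :=
  R' ∈ F ∧ R' ⊂ R ∧ c * ((R ∩ S).card : ℝ) ≤ ((R' ∩ S).card : ℝ) ∧
    ((R' ∩ S).card : ℝ) ≤ (1 - c) * ((R ∩ S).card : ℝ)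

open Classical in
/-- Every member of `F` with at least two points of `S` has a balanced part. -/
def HasBalancedParts {U : Type} (F : Set (Finset U)) (c : ℝ) : Prop :=
  ∀ S : Finset U, ∀ R ∈ F, 2 ≤ (R ∩ S).card → ∃ R' : Finset U, IsBalancedPart F c S R R'

open Classical in
/-- For every `R ∈ F` and `δ ∈ (0,1)` there is an algorithm that never uses more than
`C * log (2 / δ)` subset samples, all of them on `R`, and that, if `R ∩ S` has at least two points,
returns a balanced part of `R` with probability at least `1 - δ`. -/
def BalancedPartsFindable {U : Type} (F : Set (Finset U)) (c C : ℝ) : Prop :=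
  ∀ R ∈ F, ∀ δ : ℝ, 0 < δ → δ < 1 → ∃ B : SamplingAlg ({R} : Set (Finset U)) (Finset U),
    ∀ S : Finset U,
      (∀ x ∈ (B.run S).support, (x.2 : ℝ) ≤ C * Real.log (2 / δ)) ∧
      (2 ≤ (R ∩ S).card → 1 - δ ≤ probOf (B.run S) (fun x => IsBalancedPart F c S R x.1))

/-- The `d`-dimensional sub-grids (boxes) of the grid with `k ^ d` points. -/
def subgrids (d k : ℕ) : Set (Finset (Fin d → Fin k)) :=
  {R | ∃ a b : Fin d → Fin k, a ≤ b ∧ R = Finset.Icc a b}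

/-- The sub-cubes of the Boolean hypercube: the coordinates in `I` are fixed. -/
def subcubes (d : ℕ) : Set (Finset (Fin d → Bool)) :=
  {Q | ∃ (I : Finset (Fin d)) (v : Fin d → Bool),
    Q = Finset.univ.filter fun x => ∀ i ∈ I, x i = v i}

/-!
Both families of sets admit balanced parts for elementary reasons. In a grid, cut every coordinate at
a quantile of `R ∩ S`. If no half-space and no hyperplane at these values is balanced, then almost
all points lie in each of the hyperplanes, hence in their intersection, which is a single point
(`exists_gridCut_or_card_ne_lt`, `card_lt_of_card_ne_lt`). In the hypercube, fix the coordinates one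
after the other to the value of the majority of the remaining points, until at most two thirds are
left (`exists_prefixCube_card`).

Finding a balanced part uses these arguments with random points in place of quantiles. One or two
random points of `R ∩ S` determine boundedly many candidates, one of which is balanced with
probability bounded below: for grids the cuts at the coordinates of a random point, for the
hypercube the sub-cubes of points that agree with one random point `x` at least as long as, or
longer than, another random point `y` does. The reason is that a random point is rarely near an end
of a linear preorder (`card_middle_ge`). It remains to repeat this `O(log (2 / δ))` times and to test
all candidates on `O(log (2 / δ))` further samples, with a Chernoff bound and a union bound
(`exists_balancedPartsFindable`).

For the size of `S`, follow a chain `U = R₀ ⊃ R₁ ⊃ ...` of balanced parts until one point is left,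
and estimate `1 / |S|` by the product of the empirical frequencies of `Rⱼ₊₁` in `Rⱼ` (`estimate`).
With `O((j + 1) ^ 2 / ε ^ 2)` samples on level `j` the relative variances have a sum of order
`ε ^ 2`, and Chebyshev's inequality applies to the product (`expect_estimate_error`). The depth of
the chain is `O(log |S|)` if no search fails. Searches on level `j` fail with probability at
most `exp (-12 (j + 1) ^ 2)`, which makes failures negligible even for the exponential moment of the
number of samples (`expect_exp_cost_le`). Its logarithm is `O(log ^ 3 |S|)`, after scaling by
`ε ^ 2`, and Markov's inequality gives the tail bound.

All probabilities are computed with `SamplingAlg.expect`, a real-valued expectation defined by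
recursion on the algorithm as iterated finite averages, which agrees with the law `SamplingAlg.run`
(`SamplingAlg.probOf_run`).
-/

/-! ### Expectations of sampling algorithms -/

open Classical in
/-- The points of the hidden set `S` that lie in `T`. -/
noncomputable def hits {U : Type} (S T : Finset U) : Finset U := T ∩ S

theorem mem_hits {U : Type} {S T : Finset U} {x : U} : x ∈ hits S T ↔ x ∈ T ∧ x ∈ S := by
  classical
  simp [hits]

theorem hits_subset {U : Type} (S : Finset U) {T T' : Finset U} (h : T' ⊆ T) :
    hits S T' ⊆ hits S T := fun x hx => by
  rw [mem_hits] at *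
  exact ⟨h hx.1, hx.2⟩

theorem isBalancedPart_of_card {U : Type} {F : Set (Finset U)} {c : ℝ} {S R R' : Finset U}
    (hc : 0 < c) (hR : 2 ≤ (hits S R).card) (hF : R' ∈ F) (hsub : R' ⊆ R)
    (h1 : c * (hits S R).card ≤ (hits S R').card)
    (h2 : ((hits S R').card : ℝ) ≤ (1 - c) * (hits S R).card) : IsBalancedPart F c S R R' := by
  refine ⟨hF, hsub.ssubset_of_ne ?_, h1, h2⟩
  rintro rfl
  have : (2 : ℝ) ≤ (hits S R').card := by exact_mod_cast hR
  nlinarith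

/-- The mean of `f` over the answer to a subset sample on `T`. -/
noncomputable def sampleMean {U : Type} (S T : Finset U) (f : Option U → ℝ) : ℝ :=
  open Classical in
  if (hits S T).Nonempty then (∑ x ∈ hits S T, f (some x)) / (hits S T).card else f none

section sampleMean

variable {U : Type} {S T : Finset U}

theorem sampleMean_of_nonempty (h : (hits S T).Nonempty) (f : Option U → ℝ) :
    sampleMean S T f = (∑ x ∈ hits S T, f (some x)) / (hits S T).card := by
  rw [sampleMean, if_pos h]

theorem sampleMean_of_empty (h : ¬ (hits S T).Nonempty) (f : Option U → ℝ) :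
    sampleMean S T f = f none := by
  rw [sampleMean, if_neg h]

/-- The possible answers to a subset sample on `T`. -/
def IsAnswer (S T : Finset U) (a : Option U) : Prop :=
  ((hits S T).Nonempty → ∃ x ∈ hits S T, a = some x) ∧ (¬ (hits S T).Nonempty → a = none)

theorem sampleMean_mono_of_isAnswer {f g : Option U → ℝ}
    (h : ∀ a, IsAnswer S T a → f a ≤ g a) : sampleMean S T f ≤ sampleMean S T g := by
  by_cases hn : (hits S T).Nonempty
  · rw [sampleMean_of_nonempty hn, sampleMean_of_nonempty hn]
    gcongr with x hx
    exact h _ ⟨fun _ => ⟨x, hx, rfl⟩, fun h' => absurd hn h'⟩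
  · rw [sampleMean_of_empty hn, sampleMean_of_empty hn]
    exact h _ ⟨fun h' => absurd h' hn, fun _ => rfl⟩

theorem sampleMean_mono {f g : Option U → ℝ} (h : ∀ a, f a ≤ g a) :
    sampleMean S T f ≤ sampleMean S T g :=
  sampleMean_mono_of_isAnswer fun a _ => h a

theorem sampleMean_const (c : ℝ) : sampleMean S T (fun _ => c) = c := by
  by_cases hn : (hits S T).Nonempty
  · rw [sampleMean_of_nonempty hn]
    have : ((hits S T).card : ℝ) ≠ 0 := by exact_mod_cast hn.card_pos.ne'
    simp only [Finset.sum_const, nsmul_eq_mul]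
    field_simp
  · rw [sampleMean_of_empty hn]

theorem sampleMean_add (f g : Option U → ℝ) :
    sampleMean S T (fun a => f a + g a) = sampleMean S T f + sampleMean S T g := by
  by_cases hn : (hits S T).Nonempty
  · simp only [sampleMean_of_nonempty hn, Finset.sum_add_distrib, add_div]
  · simp only [sampleMean_of_empty hn]

theorem sampleMean_mul_left (c : ℝ) (f : Option U → ℝ) :
    sampleMean S T (fun a => c * f a) = c * sampleMean S T f := by
  by_cases hn : (hits S T).Nonempty
  · simp only [sampleMean_of_nonempty hn, ← Finset.mul_sum, mul_div_assoc]
  · simp only [sampleMean_of_empty hn]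

end sampleMean

namespace SamplingAlg

variable {U : Type} {F G : Set (Finset U)} {O O' : Type}

/-- The expectation of `f (output) (number of samples)` on hidden set `S`. -/
noncomputable def expect (S : Finset U) : SamplingAlg F O → (O → ℕ → ℝ) → ℝ
  | .done o, f => f o 0
  | .sample T _ next, f => sampleMean S T fun a => (next a).expect S fun o n => f o (n + 1)
  | .coin next, f => ((next true).expect S f + (next false).expect S f) / 2

/-- Run `A`, then continue with `k` on its output. -/
def bind : SamplingAlg F O → (O → SamplingAlg F O') → SamplingAlg F O'
  | .done o, k => k o
  | .sample T hT next, k => .sample T hT fun a => (next a).bind k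
  | .coin next, k => .coin fun b => (next b).bind k

/-- The same algorithm, with access to a larger family. -/
def weaken (h : F ⊆ G) : SamplingAlg F O → SamplingAlg G O
  | .done o => .done o
  | .sample T hT next => .sample T (h hT) fun a => (next a).weaken h
  | .coin next => .coin fun b => (next b).weaken h

/-- `P (output) (number of samples)` holds on every branch, whatever the answers are. -/
def Always : SamplingAlg F O → (O → ℕ → Prop) → Prop
  | .done o, P => P o 0
  | .sample _ _ next, P => ∀ a, (next a).Always fun o n => P o (n + 1)
  | .coin next, P => ∀ b, (next b).Always P

theorem expect_bind (S : Finset U) (A : SamplingAlg F O) (k : O → SamplingAlg F O')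
    (f : O' → ℕ → ℝ) :
    (A.bind k).expect S f = A.expect S fun o n => (k o).expect S fun o' n' => f o' (n + n') := by
  induction A generalizing f with
  | done o => simp [bind, expect]
  | sample T hT next ih =>
    simp only [bind, expect, ih]
    simp only [Nat.add_right_comm]
  | coin next ih => simp only [bind, expect, ih]

theorem expect_weaken (h : F ⊆ G) (S : Finset U) (A : SamplingAlg F O) (f : O → ℕ → ℝ) :
    (A.weaken h).expect S f = A.expect S f := by
  induction A generalizing f with
  | done o => rfl
  | sample T hT next ih => simp only [weaken, expect, ih]
  | coin next ih => simp only [weaken, expect, ih]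

theorem Always.bind {A : SamplingAlg F O} {k : O → SamplingAlg F O'} {P : O → ℕ → Prop}
    {Q : O' → ℕ → Prop} (hA : A.Always P)
    (hk : ∀ o n, P o n → (k o).Always fun o' n' => Q o' (n + n')) : (A.bind k).Always Q := by
  induction A generalizing P Q with
  | done o => simpa [SamplingAlg.bind] using hk o 0 hA
  | sample T hT next ih =>
    intro a
    refine ih a (hA a) fun o n h => ?_
    simpa only [Nat.add_right_comm] using hk o (n + 1) h
  | coin next ih => exact fun b => ih b (hA b) hk

theorem expect_mono {S : Finset U} {A : SamplingAlg F O} {f g : O → ℕ → ℝ}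
    (h : ∀ o n, f o n ≤ g o n) : A.expect S f ≤ A.expect S g := by
  induction A generalizing f g with
  | done o => exact h _ _
  | sample T hT next ih => exact sampleMean_mono fun a => ih a fun o n => h o (n + 1)
  | coin next ih =>
    simp only [expect]
    linarith [ih true h, ih false h]

theorem expect_const (S : Finset U) (A : SamplingAlg F O) (c : ℝ) :
    A.expect S (fun _ _ => c) = c := by
  induction A with
  | done o => rfl
  | sample T hT next ih => simp only [expect, ih, sampleMean_const]
  | coin next ih => simp only [expect, ih]; ring

theorem expect_add (S : Finset U) (A : SamplingAlg F O) (f g : O → ℕ → ℝ) :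
    A.expect S (fun o n => f o n + g o n) = A.expect S f + A.expect S g := by
  induction A generalizing f g with
  | done o => rfl
  | sample T hT next ih => simp only [expect, ih, sampleMean_add]
  | coin next ih => simp only [expect, ih]; ring

theorem expect_mul_left (S : Finset U) (A : SamplingAlg F O) (c : ℝ) (f : O → ℕ → ℝ) :
    A.expect S (fun o n => c * f o n) = c * A.expect S f := by
  induction A generalizing f with
  | done o => rfl
  | sample T hT next ih => simp only [expect, ih, sampleMean_mul_left]
  | coin next ih => simp only [expect, ih]; ring

theorem expect_list_sum {ι : Type} (S : Finset U) (A : SamplingAlg F O) (l : List ι)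
    (f : ι → O → ℕ → ℝ) :
    A.expect S (fun o n => (l.map fun i => f i o n).sum)
      = (l.map fun i => A.expect S (f i)).sum := by
  induction l with
  | nil => simpa using expect_const S A 0
  | cons i l ih => simp only [List.map_cons, List.sum_cons, expect_add, ih]

theorem subsetSample_of_nonempty {S T : Finset U} (h : (hits S T).Nonempty) :
    subsetSample S T = (PMF.uniformOfFinset (hits S T) h).map some := dif_pos h

theorem subsetSample_of_empty {S T : Finset U} (h : ¬ (hits S T).Nonempty) :
    subsetSample S T = PMF.pure none := dif_neg h

theorem toOuterMeasure_ne_top {α : Type} (p : PMF α) (E : Set α) : p.toOuterMeasure E ≠ ⊤ := by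
  rw [PMF.toOuterMeasure_apply]
  refine ne_top_of_le_ne_top ENNReal.one_ne_top ?_
  rw [← p.tsum_coe]
  exact ENNReal.tsum_le_tsum fun a => Set.indicator_le_self' (fun _ _ => zero_le) a

theorem subsetSample_bind_apply (S T : Finset U) {α : Type} (q : Option U → PMF α) (E : Set α) :
    (((subsetSample S T).bind q).toOuterMeasure E).toReal
      = sampleMean S T fun a => ((q a).toOuterMeasure E).toReal := by
  classical
  by_cases hn : (hits S T).Nonempty
  · rw [sampleMean_of_nonempty hn, subsetSample_of_nonempty hn, PMF.bind_map,
      PMF.toOuterMeasure_bind_apply, tsum_eq_sum (s := hits S T)]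
    · rw [ENNReal.toReal_sum, Finset.sum_div]
      · refine Finset.sum_congr rfl fun x hx => ?_
        rw [PMF.uniformOfFinset_apply_of_mem _ hx]
        simp only [Function.comp, ENNReal.toReal_mul, ENNReal.toReal_inv, ENNReal.toReal_natCast]
        rw [div_eq_inv_mul]
      · intro x _
        exact ENNReal.mul_ne_top (PMF.apply_ne_top _ _) (toOuterMeasure_ne_top _ _)
    · intro x hx
      rw [PMF.uniformOfFinset_apply_of_notMem _ hx, zero_mul]
  · rw [sampleMean_of_empty hn, subsetSample_of_empty hn, PMF.pure_bind]

open Classical in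
/-- Probabilities of events of a run are expectations of indicators. -/
theorem probOf_run (S : Finset U) (A : SamplingAlg F O) (E : O × ℕ → Prop) :
    probOf (A.run S) E = A.expect S fun o n => if E (o, n) then 1 else 0 := by
  induction A generalizing E with
  | done o =>
    simp only [probOf, run, expect, PMF.toOuterMeasure_pure_apply]
    split_ifs <;> simp_all
  | sample T hT next ih =>
    simp only [probOf] at ih
    simp only [probOf, run, expect, subsetSample_bind_apply, PMF.toOuterMeasure_map_apply]
    congr 1
    funext a
    exact ih a fun x => E (x.1, x.2 + 1)
  | coin next ih =>
    simp only [probOf] at ih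
    have hne : ∀ b, ((2 : ℕ) : ENNReal)⁻¹ * ((next b).run S).toOuterMeasure {x | E x} ≠ ⊤ :=
      fun b => ENNReal.mul_ne_top (by simp) (toOuterMeasure_ne_top _ _)
    simp only [probOf, run, expect, PMF.toOuterMeasure_bind_apply, tsum_bool,
      PMF.uniformOfFintype_apply, Fintype.card_bool]
    rw [ENNReal.toReal_add (hne _) (hne _)]
    simp only [ENNReal.toReal_mul, ih]
    simp
    ring

/-- An inequality that holds on the support of the run can be integrated. -/
theorem expect_mono_of_support {S : Finset U} {A : SamplingAlg F O} {f g : O → ℕ → ℝ}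
    (h : ∀ x ∈ (A.run S).support, f x.1 x.2 ≤ g x.1 x.2) : A.expect S f ≤ A.expect S g := by
  classical
  induction A generalizing f g with
  | done o => exact h (o, 0) (by simp [run])
  | sample T hT next ih =>
    refine sampleMean_mono_of_isAnswer fun a ha => ih a fun x hx => h (x.1, x.2 + 1) ?_
    rw [run, PMF.mem_support_bind_iff]
    refine ⟨a, ?_, ?_⟩
    · by_cases hn : (hits S T).Nonempty
      · obtain ⟨y, hy, rfl⟩ := ha.1 hn
        rw [subsetSample_of_nonempty hn]
        simp only [PMF.mem_support_map_iff, PMF.mem_support_uniformOfFinset_iff]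
        exact ⟨y, hy, rfl⟩
      · rw [ha.2 hn, subsetSample_of_empty hn]
        simp
    · rw [PMF.mem_support_map_iff]
      exact ⟨x, hx, rfl⟩
  | coin next ih =>
    have : ∀ b, (next b).expect S f ≤ (next b).expect S g := fun b => ih b fun x hx => h x (by
      rw [run, PMF.mem_support_bind_iff]
      exact ⟨b, by simp, hx⟩)
    simp only [expect]
    linarith [this true, this false]

theorem Always.of_mem_support {S : Finset U} {A : SamplingAlg F O} {P : O → ℕ → Prop}
    (h : A.Always P) : ∀ x ∈ (A.run S).support, P x.1 x.2 := by
  induction A generalizing P with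
  | done o =>
    intro x hx
    simp only [run, PMF.support_pure, Set.mem_singleton_iff] at hx
    subst hx
    exact h
  | sample T hT next ih =>
    intro x hx
    rw [run, PMF.mem_support_bind_iff] at hx
    obtain ⟨a, -, hx⟩ := hx
    rw [PMF.mem_support_map_iff] at hx
    obtain ⟨y, hy, rfl⟩ := hx
    exact ih a (h a) y hy
  | coin next ih =>
    intro x hx
    rw [run, PMF.mem_support_bind_iff] at hx
    obtain ⟨b, -, hx⟩ := hx
    exact ih b (h b) x hx

theorem expect_mono_of_always {S : Finset U} {A : SamplingAlg F O} {P : O → ℕ → Prop}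
    (hP : A.Always P) {f g : O → ℕ → ℝ} (h : ∀ o n, P o n → f o n ≤ g o n) :
    A.expect S f ≤ A.expect S g :=
  expect_mono_of_support fun x hx => h _ _ (hP.of_mem_support x hx)

open Classical in
theorem probOf_not (S : Finset U) (A : SamplingAlg F O) (E : O × ℕ → Prop) :
    probOf (A.run S) E = 1 - A.expect S fun o n => if E (o, n) then 0 else 1 := by
  rw [probOf_run, eq_sub_iff_add_eq, ← expect_add, ← expect_const S A 1]
  congr 1
  funext o n
  rw [expect_const]
  split_ifs <;> simp

/-! ### Lists of independent samples -/

/-- The answers to `n` subset samples on `T`. -/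
def draw (T : Finset U) (hT : T ∈ F) : ℕ → SamplingAlg F (List (Option U))
  | 0 => .done []
  | n + 1 => .sample T hT fun a => (draw T hT n).bind fun l => .done (a :: l)

theorem expect_draw_zero (S T : Finset U) (hT : T ∈ F) (f : List (Option U) → ℕ → ℝ) :
    (draw T hT 0).expect S f = f [] 0 := rfl

theorem expect_draw_succ (S T : Finset U) (hT : T ∈ F) (n : ℕ) (f : List (Option U) → ℕ → ℝ) :
    (draw T hT (n + 1)).expect S f
      = sampleMean S T fun a => (draw T hT n).expect S fun l m => f (a :: l) (m + 1) := by
  simp only [draw, expect, expect_bind, Nat.add_zero]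

theorem always_draw (T : Finset U) (hT : T ∈ F) (n : ℕ) :
    (draw T hT n).Always fun l m => l.length = n ∧ m = n := by
  induction n with
  | zero => exact ⟨rfl, rfl⟩
  | succ n ih =>
    intro a
    refine ih.bind fun l m h => ?_
    exact ⟨by simp [h.1], by simp [h.2]⟩

theorem expect_draw_mono {S T : Finset U} {hT : T ∈ F} {n : ℕ} {f g : List (Option U) → ℕ → ℝ}
    (h : ∀ l : List (Option U), l.length = n → (∀ a ∈ l, IsAnswer S T a) → f l n ≤ g l n) :
    (draw T hT n).expect S f ≤ (draw T hT n).expect S g := by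
  induction n generalizing f g with
  | zero => exact h [] rfl (by simp)
  | succ n ih =>
    rw [expect_draw_succ, expect_draw_succ]
    refine sampleMean_mono_of_isAnswer fun a ha => ih fun l hl hl' => h _ (by simp [hl]) ?_
    simpa using ⟨ha, hl'⟩

/-- Independence: the expectation of a product over the samples is a power. -/
theorem expect_draw_prod (S T : Finset U) (hT : T ∈ F) (n : ℕ) (φ : Option U → ℝ) :
    (draw T hT n).expect S (fun l _ => (l.map φ).prod) = sampleMean S T φ ^ n := by
  induction n with
  | zero => simp [expect_draw_zero]
  | succ n ih =>
    simp only [expect_draw_succ, List.map_cons, List.prod_cons, expect_mul_left, ih]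
    simp only [mul_comm (φ _), sampleMean_mul_left]
    ring

theorem expect_draw_sum (S T : Finset U) (hT : T ∈ F) (n : ℕ) (φ : Option U → ℝ) :
    (draw T hT n).expect S (fun l _ => (l.map φ).sum) = n * sampleMean S T φ := by
  induction n with
  | zero => simp [expect_draw_zero]
  | succ n ih =>
    simp only [expect_draw_succ, List.map_cons, List.sum_cons, expect_add, ih, expect_const,
      sampleMean_add, sampleMean_const]
    push_cast
    ring

theorem expect_draw_sum_sq (S T : Finset U) (hT : T ∈ F) (n : ℕ) (φ : Option U → ℝ) :
    (draw T hT n).expect S (fun l _ => (l.map φ).sum ^ 2)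
      = n * sampleMean S T (fun a => φ a ^ 2) + n * (n - 1) * sampleMean S T φ ^ 2 := by
  induction n with
  | zero => simp [expect_draw_zero]
  | succ n ih =>
    have : ∀ (a : Option U) (l : List (Option U)), ((a :: l).map φ).sum ^ 2
        = φ a ^ 2 + (2 * φ a * (l.map φ).sum + (l.map φ).sum ^ 2) := fun a l => by
      simp only [List.map_cons, List.sum_cons]
      ring
    simp only [expect_draw_succ, this, expect_add, expect_mul_left, ih, expect_const,
      sampleMean_add, sampleMean_const, expect_draw_sum]
    simp only [mul_comm (2 * φ _), ← mul_assoc, sampleMean_mul_left]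
    push_cast
    ring

open Classical in
/-- A Chernoff bound for the samples of a centred bounded variable. -/
theorem expect_draw_chernoff (S T : Finset U) (hT : T ∈ F) (n : ℕ) (φ : Option U → ℝ)
    (hφ : ∀ a, |φ a| ≤ 1) (hmean : sampleMean S T φ = 0) (r : ℝ) (hr : 0 ≤ r) (hr1 : r ≤ 1) :
    (draw T hT n).expect S (fun l _ => if r * n ≤ (l.map φ).sum then 1 else 0)
      ≤ Real.exp (-(r ^ 2 / 4) * n) := by
  have hmgf : sampleMean S T (fun a => Real.exp (r / 2 * φ a)) ≤ Real.exp (r ^ 2 / 4) := by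
    calc sampleMean S T (fun a => Real.exp (r / 2 * φ a))
        ≤ sampleMean S T (fun a => (1 + r ^ 2 / 4) + r / 2 * φ a) := by
          refine sampleMean_mono fun a => ?_
          have h1 : |r / 2 * φ a| ≤ 1 := by
            rw [abs_mul, abs_of_nonneg (by positivity : 0 ≤ r / 2)]
            nlinarith [hφ a, abs_nonneg (φ a)]
          have h2 := (abs_le.mp (Real.abs_exp_sub_one_sub_id_le h1)).2
          have h3 : φ a ^ 2 ≤ 1 := by
            rw [← sq_abs]
            nlinarith [hφ a, abs_nonneg (φ a)]
          nlinarith [sq_nonneg r]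
      _ = 1 + r ^ 2 / 4 := by
          rw [sampleMean_add, sampleMean_const, sampleMean_mul_left, hmean]
          ring
      _ ≤ Real.exp (r ^ 2 / 4) := by linarith [Real.add_one_le_exp (r ^ 2 / 4)]
  have hprod : ∀ l : List (Option U),
      (l.map fun a => Real.exp (r / 2 * φ a)).prod = Real.exp (r / 2 * (l.map φ).sum) := by
    intro l
    induction l with
    | nil => simp
    | cons a l ih => simp only [List.map_cons, List.prod_cons, List.sum_cons, ih, mul_add,
        Real.exp_add]
  calc (draw T hT n).expect S (fun l _ => if r * n ≤ (l.map φ).sum then (1 : ℝ) else 0)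
      ≤ (draw T hT n).expect S (fun l _ => Real.exp (-(r / 2 * (r * n)))
          * (l.map fun a => Real.exp (r / 2 * φ a)).prod) := by
        refine expect_mono fun l _ => ?_
        rw [hprod, ← Real.exp_add]
        split_ifs with h
        · rw [Real.one_le_exp_iff]
          nlinarith
        · positivity
    _ = Real.exp (-(r / 2 * (r * n))) * sampleMean S T (fun a => Real.exp (r / 2 * φ a)) ^ n := by
        rw [expect_mul_left, expect_draw_prod]
    _ ≤ Real.exp (-(r / 2 * (r * n))) * Real.exp (r ^ 2 / 4) ^ n := by
        gcongr
        rw [← sampleMean_const (S := S) (T := T) 0]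
        exact sampleMean_mono fun a => (Real.exp_pos _).le
    _ = Real.exp (-(r ^ 2 / 4) * n) := by
        rw [← Real.exp_nat_mul, ← Real.exp_add]
        congr 1
        ring

end SamplingAlg

/-! ### Finding a balanced part among random candidates -/

open Classical in
/-- The indicator function of `Q` on the answers to subset samples. -/
noncomputable def answerIn {U : Type} (Q : Finset U) (a : Option U) : ℝ :=
  if ∃ x ∈ Q, a = some x then 1 else 0

theorem answerIn_nonneg {U : Type} (Q : Finset U) (a : Option U) : 0 ≤ answerIn Q a := by
  unfold answerIn
  split_ifs <;> norm_num

theorem answerIn_le_one {U : Type} (Q : Finset U) (a : Option U) : answerIn Q a ≤ 1 := by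
  unfold answerIn
  split_ifs <;> norm_num

theorem answerIn_sq {U : Type} (Q : Finset U) (a : Option U) : answerIn Q a ^ 2 = answerIn Q a := by
  unfold answerIn
  split_ifs <;> norm_num

theorem sampleMean_answerIn {U : Type} {S R Q : Finset U} (hn : (hits S R).Nonempty)
    (hQ : Q ⊆ R) : sampleMean S R (answerIn Q) = (hits S Q).card / (hits S R).card := by
  classical
  rw [sampleMean_of_nonempty hn]
  congr 1
  simp only [answerIn, Option.some.injEq, exists_eq_right', Finset.sum_boole]
  congr 2
  ext x
  simp only [Finset.mem_filter, mem_hits]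
  exact ⟨fun h => ⟨h.2, h.1.2⟩, fun h => ⟨⟨hQ h.1, h.2⟩, h.1⟩⟩

/-- Markov's inequality: a nonnegative function that is at least `d` on a fraction `p` of the points
of `R ∩ S` has mean at least `p d`. -/
theorem le_sampleMean_of_subset {U : Type} {S R X : Finset U} {f : Option U → ℝ} {p d : ℝ}
    (hn : (hits S R).Nonempty) (hX : X ⊆ hits S R) (hp : p * (hits S R).card ≤ X.card)
    (hd : 0 ≤ d) (h0 : ∀ a, 0 ≤ f a) (hf : ∀ x ∈ X, d ≤ f (some x)) :
    p * d ≤ sampleMean S R f := by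
  have hpos : (0 : ℝ) < (hits S R).card := by exact_mod_cast hn.card_pos
  rw [sampleMean_of_nonempty hn, le_div_iff₀ hpos]
  calc p * d * (hits S R).card = p * (hits S R).card * d := by ring
    _ ≤ X.card * d := by gcongr
    _ = ∑ _x ∈ X, d := by simp
    _ ≤ ∑ x ∈ X, f (some x) := Finset.sum_le_sum hf
    _ ≤ ∑ x ∈ hits S R, f (some x) :=
      Finset.sum_le_sum_of_subset_of_nonneg hX fun x _ _ => h0 _

namespace SamplingAlg

variable {U : Type} {F G : Set (Finset U)}

/-- The candidates proposed for two answers to subset samples. -/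
def pairCandidates (cand : U → U → List (Finset U)) (a b : Option U) : List (Finset U) :=
  (a.bind fun x => b.map fun y => cand x y).getD []

/-- The candidates proposed for `n` independent pairs of subset samples on `R`. -/
def gather (R : Finset U) (hR : R ∈ G) (cand : U → U → List (Finset U)) :
    ℕ → SamplingAlg G (List (Finset U))
  | 0 => .done []
  | n + 1 => .sample R hR fun a => .sample R hR fun b =>
      (gather R hR cand n).bind fun cs => .done (pairCandidates cand a b ++ cs)

theorem always_gather (R : Finset U) (hR : R ∈ G) (cand : U → U → List (Finset U)) (q : ℕ)
    (hq : ∀ x y, (cand x y).length ≤ q) (n : ℕ) :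
    (gather R hR cand n).Always fun cs m => cs.length ≤ q * n ∧ m = 2 * n := by
  induction n with
  | zero => exact ⟨by simp, rfl⟩
  | succ n ih =>
    intro a b
    refine ih.bind fun cs m h => ?_
    have : (pairCandidates cand a b).length ≤ q := by
      rcases a with - | x <;> rcases b with - | y <;> simp [pairCandidates, hq]
    refine ⟨?_, by simp [h.2]; ring⟩
    rw [List.length_append]
    linarith [h.1]

open Classical in
/-- The probability that none of the candidates is good decays geometrically. -/
theorem expect_gather (S R : Finset U) (hR : R ∈ G) (cand : U → U → List (Finset U))
    (Good : Finset U → Prop) (p₁ p₂ : ℝ) (hp₂ : 0 ≤ p₂) (X : Finset U)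
    (hn : (hits S R).Nonempty) (hX : X ⊆ hits S R) (hp : p₁ * (hits S R).card ≤ X.card)
    (hY : ∀ x ∈ X, ∃ Y ⊆ hits S R, p₂ * (hits S R).card ≤ Y.card ∧
      ∀ y ∈ Y, ∃ Q ∈ cand x y, Good Q) (n : ℕ) :
    (gather R hR cand n).expect S (fun cs _ => if ∃ Q ∈ cs, Good Q then 0 else 1)
      ≤ (1 - p₁ * p₂) ^ n := by
  set bad : List (Finset U) → ℝ := fun cs => if ∃ Q ∈ cs, Good Q then 0 else 1 with hbad
  have hpair : sampleMean S R (fun a => sampleMean S R fun b => bad (pairCandidates cand a b))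
      ≤ 1 - p₁ * p₂ := by
    have h0 : ∀ cs, 0 ≤ 1 - bad cs := fun cs => by
      simp only [hbad]
      split_ifs <;> norm_num
    have key : p₁ * p₂ ≤ sampleMean S R (fun a => sampleMean S R fun b =>
        1 + (-1) * bad (pairCandidates cand a b)) := by
      refine le_sampleMean_of_subset hn hX hp hp₂ (fun a => ?_) fun x hx => ?_
      · rw [← sampleMean_const (S := S) (T := R) 0]
        exact sampleMean_mono fun b => by linarith [h0 (pairCandidates cand a b)]
      · obtain ⟨Y, hYs, hYc, hY⟩ := hY x hx
        rw [← mul_one p₂]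
        refine le_sampleMean_of_subset hn hYs hYc zero_le_one
          (fun b => by linarith [h0 (pairCandidates cand (some x) b)]) fun y hy => ?_
        have : bad (pairCandidates cand (some x) (some y)) = 0 := if_pos (hY y hy)
        rw [this]
        norm_num
    simp only [sampleMean_add, sampleMean_const, sampleMean_mul_left] at key
    linarith
  have hbad0 : ∀ cs, 0 ≤ bad cs := fun cs => by
    simp only [hbad]
    split_ifs <;> norm_num
  have happ : ∀ cs cs', bad (cs ++ cs') = bad cs' * bad cs := fun cs cs' => by
    by_cases h1 : ∃ Q ∈ cs, Good Q
    · have h2 : ∃ Q ∈ cs ++ cs', Good Q := by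
        obtain ⟨Q, hQ, hG⟩ := h1
        exact ⟨Q, List.mem_append_left _ hQ, hG⟩
      simp only [hbad, if_pos h1, if_pos h2, mul_zero]
    · have h2 : (∃ Q ∈ cs ++ cs', Good Q) ↔ ∃ Q ∈ cs', Good Q := by
        simp only [List.mem_append, or_and_right, exists_or, h1, false_or]
      simp only [hbad, if_neg h1, h2, mul_one]
  change (gather R hR cand n).expect S (fun cs _ => bad cs) ≤ _
  induction n with
  | zero => simp [gather, expect, hbad]
  | succ n ih =>
    simp only [gather, expect, expect_bind, happ]
    simp only [mul_comm (bad _) (bad (pairCandidates cand _ _)), expect_mul_left]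
    simp only [mul_comm (bad (pairCandidates cand _ _)), sampleMean_mul_left]
    rw [pow_succ]
    have h1 : 0 ≤ sampleMean S R
        (fun a => sampleMean S R fun b => bad (pairCandidates cand a b)) := by
      rw [← sampleMean_const (S := S) (T := R) 0]
      refine sampleMean_mono fun a => ?_
      rw [← sampleMean_const (S := S) (T := R) 0]
      exact sampleMean_mono fun b => hbad0 _
    exact mul_le_mul ih hpair h1 (h1.trans hpair |> (pow_nonneg · n))

/-- The empirical test: `Q` is a part of `R` in `F` that contains between a fraction `r` and a
fraction `1 - r` of the samples. -/
def Accepts (F : Set (Finset U)) (R : Finset U) (r : ℝ) (l : List (Option U)) (Q : Finset U) :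
    Prop :=
  Q ∈ F ∧ Q ⊆ R ∧ r * l.length ≤ (l.map (answerIn Q)).sum ∧
    (l.map (answerIn Q)).sum ≤ (1 - r) * l.length

open Classical in
/-- A candidate that passes the empirical test, if there is one. -/
noncomputable def select (F : Set (Finset U)) (R : Finset U) (r : ℝ) (cs : List (Finset U))
    (l : List (Option U)) : Finset U :=
  if h : ∃ Q ∈ cs, Accepts F R r l Q then h.choose else ∅

/-- Gather candidates from `n` pairs of samples, and test them on `n` further samples. -/
noncomputable def findPart (F : Set (Finset U)) (R : Finset U) (hR : R ∈ G) (r : ℝ)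
    (cand : U → U → List (Finset U)) (n : ℕ) : SamplingAlg G (Finset U) :=
  (gather R hR cand n).bind fun cs => (draw R hR n).bind fun l => .done (select F R r cs l)

theorem always_findPart (F : Set (Finset U)) (R : Finset U) (hR : R ∈ G) (r : ℝ)
    (cand : U → U → List (Finset U)) (n : ℕ) (q : ℕ) (hq : ∀ x y, (cand x y).length ≤ q) :
    (findPart F R hR r cand n).Always fun _ m => m = 3 * n := by
  refine (always_gather R hR cand q hq n).bind fun cs m h => ?_
  refine (always_draw R hR n).bind fun l m' h' => ?_
  change m + (m' + 0) = _
  rw [h.2, h'.2]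
  ring

open Classical in
/-- The empirical frequency of `Q` deviates by `r` from the true one with exponentially small
probability. -/
theorem expect_deviation {S R Q : Finset U} (hR : R ∈ G) (hn : (hits S R).Nonempty) (hQ : Q ⊆ R)
    (n : ℕ) (r : ℝ) (hr : 0 ≤ r) (hr1 : r ≤ 1) :
    (draw R hR n).expect S (fun l _ =>
      if r * n ≤ |(l.map (answerIn Q)).sum - (hits S Q).card / (hits S R).card * l.length|
        then 1 else 0) ≤ 2 * Real.exp (-(r ^ 2 / 4) * n) := by
  set p : ℝ := (hits S Q).card / (hits S R).card with hp
  have hmean := sampleMean_answerIn hn hQ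
  have hp0 : 0 ≤ p := by positivity
  have hp1 : p ≤ 1 := by
    rw [hp, ← hmean, ← sampleMean_const (S := S) (T := R) 1]
    exact sampleMean_mono fun a => answerIn_le_one Q a
  have h1 := expect_draw_chernoff S R hR n (fun a => -p + answerIn Q a)
    (fun a => abs_le.mpr ⟨by linarith [answerIn_nonneg Q a], by linarith [answerIn_le_one Q a]⟩)
    (by rw [sampleMean_add, sampleMean_const, hmean]; ring) r hr hr1
  have h2 := expect_draw_chernoff S R hR n (fun a => p + -1 * answerIn Q a)
    (fun a => abs_le.mpr ⟨by linarith [answerIn_le_one Q a], by linarith [answerIn_nonneg Q a]⟩)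
    (by rw [sampleMean_add, sampleMean_const, sampleMean_mul_left, hmean]; ring) r hr hr1
  have hs1 : ∀ l : List (Option U), (l.map fun a => -p + answerIn Q a).sum
      = (l.map (answerIn Q)).sum - p * l.length := fun l => by
    rw [List.sum_map_add]
    simp
    ring
  have hs2 : ∀ l : List (Option U), (l.map fun a => p + -1 * answerIn Q a).sum
      = -((l.map (answerIn Q)).sum - p * l.length) := fun l => by
    rw [List.sum_map_add, List.sum_map_mul_left]
    simp
    ring
  simp only [hs1] at h1
  simp only [hs2] at h2
  calc _ ≤ (draw R hR n).expect S (fun l _ =>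
        (if r * n ≤ (l.map (answerIn Q)).sum - p * l.length then (1 : ℝ) else 0)
        + (if r * n ≤ -((l.map (answerIn Q)).sum - p * l.length) then 1 else 0)) := by
        refine expect_mono fun l _ => ?_
        split_ifs with h h' h'' h'' <;> norm_num
        rcases le_abs.mp h with h | h <;> contradiction
    _ ≤ _ := by
        rw [expect_add]
        linarith

open Classical in
/-- The search fails only if no candidate is good, or if the empirical frequency of some
candidate deviates by `s / 4`. -/
theorem expect_findPart {S R : Finset U} (hR : R ∈ G) (hn : 2 ≤ (hits S R).card) (s : ℝ)
    (hs : 0 < s) (hs1 : s ≤ 1) (cand : U → U → List (Finset U)) (q n : ℕ)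
    (hq : ∀ x y, (cand x y).length ≤ q) (p₁ p₂ : ℝ) (hp₂ : 0 ≤ p₂) (X : Finset U)
    (hX : X ⊆ hits S R) (hp : p₁ * (hits S R).card ≤ X.card)
    (hY : ∀ x ∈ X, ∃ Y ⊆ hits S R, p₂ * (hits S R).card ≤ Y.card ∧
      ∀ y ∈ Y, ∃ Q ∈ cand x y, IsBalancedPart F s S R Q) :
    (findPart F R hR (3 * s / 4) cand n).expect S
        (fun Q _ => if IsBalancedPart F (s / 2) S R Q then 0 else 1)
      ≤ (1 - p₁ * p₂) ^ n + q * n * (2 * Real.exp (-((s / 4) ^ 2 / 4) * n)) := by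
  have hne : (hits S R).Nonempty := Finset.card_pos.mp (by omega)
  have hpos : (0 : ℝ) < (hits S R).card := by exact_mod_cast hne.card_pos
  set D : Finset U → List (Option U) → ℝ := fun Q l => if Q ⊆ R then
      if s / 4 * n ≤ |(l.map (answerIn Q)).sum - (hits S Q).card / (hits S R).card * l.length|
        then 1 else 0
      else 0 with hD
  set E := 2 * Real.exp (-((s / 4) ^ 2 / 4) * n) with hE
  have hD0 : ∀ Q l, 0 ≤ D Q l := fun Q l => by
    simp only [hD]
    split_ifs <;> norm_num
  have hDE : ∀ Q, (draw R hR n).expect S (fun l _ => D Q l) ≤ E := fun Q => by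
    by_cases hQ : Q ⊆ R
    · simp only [hD, if_pos hQ]
      exact expect_deviation hR hne hQ n (s / 4) (by positivity) (by linarith)
    · simp only [hD, if_neg hQ, expect_const]
      positivity
  -- Without deviations, every accepted candidate is balanced, and a well balanced one is accepted.
  have hpoint : ∀ (cs : List (Finset U)) (l : List (Option U)), l.length = n →
      (if IsBalancedPart F (s / 2) S R (select F R (3 * s / 4) cs l) then (0 : ℝ) else 1)
        ≤ (if ∃ Q ∈ cs, IsBalancedPart F s S R Q then 0 else 1) + (cs.map fun Q => D Q l).sum := by
    intro cs l hl
    have hsum0 : 0 ≤ (cs.map fun Q => D Q l).sum :=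
      List.sum_nonneg (by simpa using fun Q _ => hD0 Q l)
    by_cases hdev : ∃ Q ∈ cs, D Q l = 1
    · obtain ⟨Q, hQ, h1⟩ := hdev
      have : (1 : ℝ) ≤ (cs.map fun Q => D Q l).sum := by
        rw [← h1]
        exact List.single_le_sum (by simpa using fun Q _ => hD0 Q l) _
          (List.mem_map.mpr ⟨Q, hQ, rfl⟩)
      split_ifs <;> linarith
    by_cases hgood : ∃ Q ∈ cs, IsBalancedPart F s S R Q
    swap
    · rw [if_neg hgood]
      split_ifs <;> linarith
    push Not at hdev
    have hnodev : ∀ Q ∈ cs, Q ⊆ R →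
        |(l.map (answerIn Q)).sum - (hits S Q).card / (hits S R).card * l.length|
          < s / 4 * l.length := by
      intro Q hQ hsub
      have := hdev Q hQ
      simp only [hD, if_pos hsub] at this
      rw [hl] at this ⊢
      by_contra h
      exact this (if_pos (not_lt.mp h))
    have hacc : ∃ Q ∈ cs, Accepts F R (3 * s / 4) l Q := by
      obtain ⟨Q, hQ, hF, hss, h1, h2⟩ := hgood
      change s * ((hits S R).card : ℝ) ≤ (hits S Q).card at h1
      change ((hits S Q).card : ℝ) ≤ (1 - s) * (hits S R).card at h2
      rw [← le_div_iff₀ hpos] at h1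
      rw [← div_le_iff₀ hpos] at h2
      obtain ⟨h3, h4⟩ := abs_lt.mp (hnodev Q hQ hss.subset)
      have hl0 : (0 : ℝ) ≤ l.length := by positivity
      exact ⟨Q, hQ, hF, hss.subset, by nlinarith, by nlinarith⟩
    have hsel : select F R (3 * s / 4) cs l = hacc.choose := dif_pos hacc
    obtain ⟨hmem, hF, hsub, h1, h2⟩ := hacc.choose_spec
    rw [← hsel] at hmem hF hsub h1 h2
    set Q := select F R (3 * s / 4) cs l
    have h3 := hnodev Q hmem hsub
    have hl0 : (0 : ℝ) < l.length := by
      have := (abs_nonneg _).trans_lt h3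
      by_contra h
      nlinarith
    obtain ⟨h3, h4⟩ := abs_lt.mp h3
    have h5 : s / 2 ≤ (hits S Q).card / (hits S R).card := by
      by_contra h
      nlinarith
    have h6 : ((hits S Q).card : ℝ) / (hits S R).card ≤ 1 - s / 2 := by
      by_contra h
      nlinarith
    have hbal : IsBalancedPart F (s / 2) S R Q :=
      isBalancedPart_of_card (by positivity) hn hF hsub ((le_div_iff₀ hpos).mp h5)
        ((div_le_iff₀ hpos).mp h6)
    rw [if_pos hbal, if_pos hgood]
    linarith
  simp only [findPart, expect_bind, expect]
  calc _ ≤ (gather R hR cand n).expect S (fun cs _ =>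
        (if ∃ Q ∈ cs, IsBalancedPart F s S R Q then 0 else 1) + q * n * E) := by
        refine expect_mono_of_always (always_gather R hR cand q hq n) fun cs _ hcs => ?_
        calc _ ≤ (draw R hR n).expect S (fun l _ =>
              (if ∃ Q ∈ cs, IsBalancedPart F s S R Q then 0 else 1)
                + (cs.map fun Q => D Q l).sum) :=
              expect_draw_mono fun l hl _ => hpoint cs l hl
          _ ≤ _ := by
              rw [expect_add, expect_const, expect_list_sum]
              gcongr
              refine (List.sum_le_card_nsmul _ E (by simpa using fun Q _ => hDE Q)).trans ?_
              rw [List.length_map, nsmul_eq_mul]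
              have : (cs.length : ℝ) ≤ q * n := by exact_mod_cast hcs.1
              gcongr
    _ ≤ _ := by
        rw [expect_add, expect_const]
        gcongr
        exact expect_gather S R hR cand _ p₁ p₂ hp₂ X hne hX hp hY n

end SamplingAlg

theorem half_le_log_two_div {δ : ℝ} (h0 : 0 < δ) (h1 : δ < 1) : 1 / 2 ≤ Real.log (2 / δ) := by
  have : Real.log 2 ≤ Real.log (2 / δ) := by
    apply Real.log_le_log (by norm_num)
    rw [le_div_iff₀ h0]
    linarith
  linarith [Real.log_two_gt_d9]

/-- If a pair of random points yields, with probability bounded below, a balanced part among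
boundedly many candidates, then balanced parts can be found with logarithmically many samples. -/
theorem exists_balancedPartsFindable (s p₁ p₂ : ℝ) (hs : 0 < s) (hs1 : s ≤ 1) (hp₁ : 0 < p₁)
    (hp₁' : p₁ ≤ 1) (hp₂ : 0 < p₂) (hp₂' : p₂ ≤ 1) (q : ℕ) : ∃ C : ℝ, ∀ {U : Type}
    (F : Set (Finset U)) (cand : Finset U → U → U → List (Finset U)),
    (∀ R x y, (cand R x y).length ≤ q) →
    (∀ S, ∀ R ∈ F, 2 ≤ (hits S R).card → ∃ X ⊆ hits S R, p₁ * (hits S R).card ≤ X.card ∧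
      ∀ x ∈ X, ∃ Y ⊆ hits S R, p₂ * (hits S R).card ≤ Y.card ∧
        ∀ y ∈ Y, ∃ Q ∈ cand R x y, IsBalancedPart F s S R Q) →
    BalancedPartsFindable F (s / 2) C := by
  classical
  set κ : ℝ := (s / 4) ^ 2 / 4 with hκ
  have hκ0 : 0 < κ := by positivity
  set μ : ℝ := min (p₁ * p₂) (κ / 2) with hμ
  have hμ0 : 0 < μ := by positivity
  set B : ℝ := 1 + 4 * q / κ with hB
  have hB1 : 1 ≤ B := by
    rw [hB]
    linarith [show 0 ≤ 4 * (q : ℝ) / κ by positivity]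
  have hlogB : 0 ≤ Real.log B := Real.log_nonneg hB1
  set D : ℝ := (2 * Real.log B + 1) / μ with hD
  refine ⟨3 * (D + 2), fun {U} F cand hq hcand R hR δ hδ0 hδ1 => ?_⟩
  set Λ := Real.log (2 / δ) with hΛ
  have hΛ2 : 1 / 2 ≤ Λ := half_le_log_two_div hδ0 hδ1
  set n : ℕ := ⌈D * Λ⌉₊ with hndef
  have hD0 : 0 ≤ D := by positivity
  have hn1 : (n : ℝ) ≤ (D + 2) * Λ := by
    have := (Nat.ceil_lt_add_one (show 0 ≤ D * Λ by positivity)).le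
    rw [← hndef] at this
    linarith
  -- `n` is large enough for the total failure probability, at most `B exp (-μ n)`, to be below `δ`.
  have hn2 : Real.log B + Λ ≤ μ * n := by
    have h1 : D * Λ ≤ n := Nat.le_ceil _
    have h2 : μ * (D * Λ) ≤ μ * n := by gcongr
    have h3 : μ * (D * Λ) = (2 * Real.log B + 1) * Λ := by
      rw [hD]
      field_simp
    nlinarith
  refine ⟨SamplingAlg.findPart F R (Set.mem_singleton R) (3 * s / 4) (cand R) n,
    fun S => ⟨fun x hx => ?_, fun h2 => ?_⟩⟩
  · have := (SamplingAlg.always_findPart F R (Set.mem_singleton R) (3 * s / 4) (cand R) n q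
      (hq R)).of_mem_support x hx
    rw [this]
    push_cast
    linarith
  · obtain ⟨X, hX, hXp, hXY⟩ := hcand S R hR h2
    have key := SamplingAlg.expect_findPart (F := F) (Set.mem_singleton R) h2 s hs hs1 (cand R) q n
      (hq R) p₁ p₂ hp₂.le X hX hXp hXY
    rw [SamplingAlg.probOf_not]
    have e1 : (1 - p₁ * p₂) ^ n ≤ Real.exp (-(μ * n)) := by
      have h1 : 1 - p₁ * p₂ ≤ Real.exp (-(p₁ * p₂)) := by
        linarith [Real.add_one_le_exp (-(p₁ * p₂))]
      have h0 : 0 ≤ 1 - p₁ * p₂ := by nlinarith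
      calc (1 - p₁ * p₂) ^ n ≤ Real.exp (-(p₁ * p₂)) ^ n := by gcongr
        _ = Real.exp (-(p₁ * p₂ * n)) := by
          rw [← Real.exp_nat_mul]
          congr 1
          ring
        _ ≤ _ := by
          gcongr
          exact min_le_left _ _
    have e2 : q * n * (2 * Real.exp (-κ * n)) ≤ 4 * q / κ * Real.exp (-(μ * n)) := by
      have h1 : (n : ℝ) ≤ 2 / κ * Real.exp (κ / 2 * n) := by
        have := Real.add_one_le_exp (κ / 2 * n)
        calc (n : ℝ) = 2 / κ * (κ / 2 * n) := by field_simp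
          _ ≤ _ := by
            gcongr
            linarith
      calc q * n * (2 * Real.exp (-κ * n))
          ≤ q * (2 / κ * Real.exp (κ / 2 * n)) * (2 * Real.exp (-κ * n)) := by gcongr
        _ = 4 * q / κ * (Real.exp (κ / 2 * n) * Real.exp (-κ * n)) := by ring
        _ = 4 * q / κ * Real.exp (-(κ / 2 * n)) := by
          rw [← Real.exp_add]
          congr 2
          ring
        _ ≤ _ := by
          gcongr
          exact min_le_right _ _
    have e3 : B * Real.exp (-(μ * n)) ≤ δ := by
      calc B * Real.exp (-(μ * n)) ≤ B * Real.exp (-(Real.log B + Λ)) := by gcongr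
        _ = δ / 2 := by
          rw [neg_add, Real.exp_add, Real.exp_neg, Real.exp_neg, Real.exp_log (by positivity),
            hΛ, Real.exp_log (by positivity)]
          field_simp
        _ ≤ δ := by linarith
    have e4 : B * Real.exp (-(μ * n)) = Real.exp (-(μ * n)) + 4 * q / κ * Real.exp (-(μ * n)) := by
      rw [hB]
      ring
    linarith

/-! ### Balanced parts from linear orders -/

theorem hits_filter {U : Type} (S R : Finset U) (P : U → Prop) [DecidablePred P] :
    hits S (R.filter P) = (hits S R).filter P := by
  ext x
  simp only [mem_hits, Finset.mem_filter]
  tauto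

open Classical in
/-- Few points have a small rank. -/
theorem card_rank_lt_le {U ι : Type} [LinearOrder ι] (A : Finset U) (φ : U → ι) (r : ℝ)
    (hr : 0 ≤ r) :
    ((A.filter fun y => ((A.filter fun z => φ z ≤ φ y).card : ℝ) < r).card : ℝ) ≤ r := by
  set B := A.filter fun y => ((A.filter fun z => φ z ≤ φ y).card : ℝ) < r with hB
  rcases B.eq_empty_or_nonempty with h | h
  · simpa [h] using hr
  · obtain ⟨y, hy, hmax⟩ := B.exists_max_image φ h
    refine le_trans ?_ (Finset.mem_filter.mp hy).2.le
    exact_mod_cast Finset.card_le_card fun z hz =>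
      Finset.mem_filter.mpr ⟨(Finset.mem_filter.mp hz).1, hmax z hz⟩

open Classical in
/-- Most points are near neither end of any of several linear preorders. -/
theorem card_middle_ge {U ι κ : Type} [LinearOrder ι] [Fintype κ] (A : Finset U) (φ : κ → U → ι)
    (s : ℝ) (hs : 0 ≤ s) :
    ∃ Y ⊆ A, (1 - 2 * s * Fintype.card κ) * A.card ≤ Y.card ∧
      ∀ y ∈ Y, ∀ i, s * A.card ≤ (A.filter fun z => φ i z ≤ φ i y).card ∧
        ((A.filter fun z => φ i z < φ i y).card : ℝ) ≤ (1 - s) * A.card := by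
  set r : ℝ := s * A.card with hr
  have hr0 : 0 ≤ r := by positivity
  set Y := A.filter fun y => ∀ i, r ≤ (A.filter fun z => φ i z ≤ φ i y).card ∧
        ((A.filter fun z => φ i z < φ i y).card : ℝ) ≤ (1 - s) * A.card with hY
  let L : κ → Finset U := fun i => A.filter fun y => ((A.filter fun z => φ i z ≤ φ i y).card : ℝ) < r
  let H : κ → Finset U := fun i => A.filter fun y => ((A.filter fun z => φ i y ≤ φ i z).card : ℝ) < r
  have hL : ∀ i, ((L i).card : ℝ) ≤ r := fun i => card_rank_lt_le A (φ i) r hr0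
  have hH : ∀ i, ((H i).card : ℝ) ≤ r := fun i =>
    card_rank_lt_le A (fun x => OrderDual.toDual (φ i x)) r hr0
  have hcover : A ⊆ Y ∪ Finset.univ.biUnion fun i => L i ∪ H i := by
    intro y hy
    by_cases hyY : y ∈ Y
    · exact Finset.mem_union_left _ hyY
    · refine Finset.mem_union_right _ ?_
      simp only [hY, Finset.mem_filter, hy, true_and, not_forall] at hyY
      obtain ⟨i, hi⟩ := hyY
      rw [Finset.mem_biUnion]
      refine ⟨i, Finset.mem_univ _, ?_⟩
      by_cases h1 : r ≤ (A.filter fun z => φ i z ≤ φ i y).card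
      · refine Finset.mem_union_right _ (Finset.mem_filter.mpr ⟨hy, ?_⟩)
        have h2 : ¬ ((A.filter fun z => φ i z < φ i y).card : ℝ) ≤ (1 - s) * A.card :=
          fun h => hi ⟨h1, h⟩
        have h3 := A.card_filter_add_card_filter_not (fun z => φ i z < φ i y)
        simp only [not_lt] at h3
        have h4 : ((A.filter fun z => φ i z < φ i y).card : ℝ)
            + (A.filter fun z => φ i y ≤ φ i z).card = A.card := by exact_mod_cast h3
        rw [hr]
        linarith
      · exact Finset.mem_union_left _ (Finset.mem_filter.mpr ⟨hy, not_le.mp h1⟩)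
  have hcard : (A.card : ℝ) ≤ Y.card + ∑ i : κ, ((L i).card + (H i).card : ℝ) := by
    have h1 := (Finset.card_le_card hcover).trans (Finset.card_union_le _ _)
    have h2 : (Finset.univ.biUnion fun i => L i ∪ H i).card ≤ ∑ i : κ, ((L i).card + (H i).card) :=
      Finset.card_biUnion_le.trans (Finset.sum_le_sum fun i _ => Finset.card_union_le _ _)
    exact_mod_cast h1.trans (by gcongr)
  have hsum : ∑ i : κ, ((L i).card + (H i).card : ℝ) ≤ ∑ _i : κ, 2 * r :=
    Finset.sum_le_sum fun i _ => by linarith [hL i, hH i]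
  rw [Finset.sum_const, nsmul_eq_mul, Finset.card_univ] at hsum
  exact ⟨Y, Finset.filter_subset _ _, by linarith, fun y hy => (Finset.mem_filter.mp hy).2⟩

/-! ### Grids -/

open Classical in
/-- Restricting one coordinate of a sub-grid to an interval gives a sub-grid, unless it is empty. -/
theorem filter_mem_subgrids {d k : ℕ} {R : Finset (Fin d → Fin k)} (hR : R ∈ subgrids d k)
    (i : Fin d) (I : Set (Fin k)) [I.OrdConnected] (hne : (R.filter fun z => z i ∈ I).Nonempty) :
    (R.filter fun z => z i ∈ I) ∈ subgrids d k := by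
  obtain ⟨a, b, -, rfl⟩ := hR
  obtain ⟨m, hm, hmin⟩ := Finset.exists_min_image _ (fun z => z i) hne
  obtain ⟨M, hM, hmax⟩ := Finset.exists_max_image _ (fun z => z i) hne
  have hm' := Finset.mem_filter.mp hm
  have hM' := Finset.mem_filter.mp hM
  simp only [Finset.mem_Icc] at hm' hM'
  have key : ((Finset.Icc a b).filter fun z => z i ∈ I)
      = Finset.Icc (Function.update a i (m i)) (Function.update b i (M i)) := by
    ext z
    simp only [Finset.mem_filter, Finset.mem_Icc, update_le_iff, le_update_iff]
    constructor
    · rintro ⟨⟨h1, h2⟩, h3⟩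
      have hz : z ∈ (Finset.Icc a b).filter fun z => z i ∈ I := by
        simp only [Finset.mem_filter, Finset.mem_Icc]
        exact ⟨⟨h1, h2⟩, h3⟩
      exact ⟨⟨hmin z hz, fun j _ => h1 j⟩, hmax z hz, fun j _ => h2 j⟩
    · rintro ⟨⟨h1, h2⟩, h3, h4⟩
      refine ⟨⟨fun j => ?_, fun j => ?_⟩, Set.OrdConnected.out ‹_› hm'.2 hM'.2 ⟨h1, h3⟩⟩
      · by_cases h : j = i
        · subst h
          exact (hm'.1.1 j).trans h1
        · exact h2 j h
      · by_cases h : j = i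
        · subst h
          exact h3.trans (hM'.1.2 j)
        · exact h4 j h
  refine ⟨_, _, ?_, key⟩
  have := hm
  rw [key, Finset.mem_Icc] at this
  exact this.1.trans this.2

open Classical in
/-- The three ways to cut a sub-grid at the value `v` of the coordinate `i`. -/
noncomputable def gridCuts {d k : ℕ} (R : Finset (Fin d → Fin k)) (i : Fin d) (v : Fin k) :
    List (Finset (Fin d → Fin k)) :=
  [R.filter fun z => z i ∈ Set.Iic v, R.filter fun z => z i ∈ Set.Iio v,
    R.filter fun z => z i ∈ ({v} : Set (Fin k))]

open Classical in
/-- If `v` is near neither end, then one of the cuts at `v` is balanced, or almost all points lie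
in the hyperplane of `v`. -/
theorem exists_gridCut_or_card_ne_lt {d k : ℕ} {S R : Finset (Fin d → Fin k)}
    (hR : R ∈ subgrids d k) (h2 : 2 ≤ (hits S R).card) (i : Fin d) (v : Fin k) {s : ℝ} (hs : 0 < s)
    (hs1 : s ≤ 1 / 3) (hle : s * (hits S R).card ≤ ((hits S R).filter fun z => z i ≤ v).card)
    (hlt : (((hits S R).filter fun z => z i < v).card : ℝ) ≤ (1 - s) * (hits S R).card) :
    (∃ Q ∈ gridCuts R i v, IsBalancedPart (subgrids d k) s S R Q) ∨
      (((hits S R).filter fun z => z i ≠ v).card : ℝ) < s * (hits S R).card := by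
  have hn : (0 : ℝ) < (hits S R).card := by exact_mod_cast (by omega : 0 < (hits S R).card)
  have hbal : ∀ (I : Set (Fin k)) [I.OrdConnected],
      s * (hits S R).card ≤ ((hits S R).filter fun z => z i ∈ I).card →
      (((hits S R).filter fun z => z i ∈ I).card : ℝ) ≤ (1 - s) * (hits S R).card →
      IsBalancedPart (subgrids d k) s S R (R.filter fun z => z i ∈ I) := by
    intro I _ h1 h3
    rw [← hits_filter] at h1 h3
    refine isBalancedPart_of_card hs h2 (filter_mem_subgrids hR i I ?_)
      (Finset.filter_subset _ _) h1 h3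
    have h0 : 0 < (hits S (R.filter fun z => z i ∈ I)).card := by
      exact_mod_cast (mul_pos hs hn).trans_le h1
    obtain ⟨z, hz⟩ := Finset.card_pos.mp h0
    exact ⟨z, (mem_hits.mp hz).1⟩
  have hsplit : (((hits S R).filter fun z => z i ≤ v).card : ℝ)
      = ((hits S R).filter fun z => z i < v).card + ((hits S R).filter fun z => z i = v).card := by
    rw [← Nat.cast_add, ← Finset.card_union_of_disjoint, ← Finset.filter_or]
    · congr 2
      ext z
      simp [le_iff_lt_or_eq]
    · exact Finset.disjoint_filter.mpr fun z _ h => h.ne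
  have hne := (hits S R).card_filter_add_card_filter_not (fun z => z i = v)
  have hne' : (((hits S R).filter fun z => z i = v).card : ℝ)
      + ((hits S R).filter fun z => z i ≠ v).card = (hits S R).card := by exact_mod_cast hne
  by_cases h3 : (((hits S R).filter fun z => z i ≤ v).card : ℝ) ≤ (1 - s) * (hits S R).card
  · exact Or.inl ⟨_, by simp [gridCuts], hbal (Set.Iic v) (by simpa using hle) (by simpa using h3)⟩
  by_cases h4 : s * (hits S R).card ≤ ((hits S R).filter fun z => z i < v).card
  · exact Or.inl ⟨_, by simp [gridCuts], hbal (Set.Iio v) (by simpa using h4) (by simpa using hlt)⟩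
  by_cases h5 : (((hits S R).filter fun z => z i = v).card : ℝ) ≤ (1 - s) * (hits S R).card
  · refine Or.inl ⟨_, by simp [gridCuts], hbal {v} ?_ ?_⟩
    · simp only [Set.mem_singleton_iff]
      nlinarith
    · simpa only [Set.mem_singleton_iff] using h5
  · right
    nlinarith

open Classical in
/-- If almost all points of `A` lie in each of the coordinate hyperplanes through `v`, then `A` has
few points, since the hyperplanes meet in one point only. -/
theorem card_lt_of_card_ne_lt {d k : ℕ} (hd : 1 ≤ d) (A : Finset (Fin d → Fin k))
    (v : Fin d → Fin k) (r : ℝ) (h : ∀ i, ((A.filter fun z => z i ≠ v i).card : ℝ) < r) :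
    (A.card : ℝ) < 1 + d * r := by
  have hcover : A ⊆ {v} ∪ Finset.univ.biUnion fun i => A.filter fun z => z i ≠ v i := by
    intro z hz
    by_cases hzv : z = v
    · simp [hzv]
    · obtain ⟨i, hi⟩ := Function.ne_iff.mp hzv
      exact Finset.mem_union_right _
        (Finset.mem_biUnion.mpr ⟨i, Finset.mem_univ _, Finset.mem_filter.mpr ⟨hz, hi⟩⟩)
  have hcard : (A.card : ℝ) ≤ 1 + ∑ i : Fin d, ((A.filter fun z => z i ≠ v i).card : ℝ) := by
    have h1 := (Finset.card_le_card hcover).trans (Finset.card_union_le _ _)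
    rw [Finset.card_singleton] at h1
    exact_mod_cast h1.trans (by gcongr; exact Finset.card_biUnion_le)
  have hsum : ∑ i : Fin d, ((A.filter fun z => z i ≠ v i).card : ℝ) < ∑ _i : Fin d, r :=
    Finset.sum_lt_sum_of_nonempty ⟨⟨0, hd⟩, Finset.mem_univ _⟩ fun i _ => h i
  simp only [Finset.sum_const, Finset.card_univ, Fintype.card_fin, nsmul_eq_mul] at hsum
  linarith

open Classical in
/-- A quantile: a value whose lower set is large, while its strict lower set is small. -/
theorem exists_quantile {U ι : Type} [LinearOrder ι] (A : Finset U) (hA : A.Nonempty) (φ : U → ι)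
    (r : ℝ) (hr : 0 < r) (hr' : r ≤ A.card) :
    ∃ y ∈ A, r ≤ (A.filter fun z => φ z ≤ φ y).card ∧
      ((A.filter fun z => φ z < φ y).card : ℝ) < r := by
  have hB : (A.filter fun y => r ≤ (A.filter fun z => φ z ≤ φ y).card).Nonempty := by
    obtain ⟨y, hy, hmax⟩ := A.exists_max_image φ hA
    refine ⟨y, Finset.mem_filter.mpr ⟨hy, ?_⟩⟩
    rwa [Finset.filter_true_of_mem hmax]
  obtain ⟨y, hy, hmin⟩ := Finset.exists_min_image _ φ hB
  obtain ⟨hyA, hyr⟩ := Finset.mem_filter.mp hy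
  refine ⟨y, hyA, hyr, ?_⟩
  rcases (A.filter fun z => φ z < φ y).eq_empty_or_nonempty with h | h
  · simpa [h] using hr
  · obtain ⟨x, hx, hmax⟩ := Finset.exists_max_image _ φ h
    obtain ⟨hxA, hxy⟩ := Finset.mem_filter.mp hx
    by_contra hge
    refine (hmin x (Finset.mem_filter.mpr ⟨hxA, (not_lt.mp hge).trans ?_⟩)).not_gt hxy
    exact_mod_cast Finset.card_le_card fun z hz =>
      Finset.mem_filter.mpr ⟨(Finset.mem_filter.mp hz).1, hmax z hz⟩

theorem hasBalancedParts_subgrids {d : ℕ} (hd : 1 ≤ d) (k : ℕ) :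
    HasBalancedParts (subgrids d k) (min (1 / 3) (1 / (2 * (d : ℝ)))) := by
  classical
  intro S R hR h2
  change 2 ≤ (hits S R).card at h2
  set c : ℝ := min (1 / 3) (1 / (2 * (d : ℝ))) with hc
  have hd' : (1 : ℝ) ≤ d := by exact_mod_cast hd
  have hc0 : 0 < c := by positivity
  have hc1 : c ≤ 1 / 3 := min_le_left _ _
  have hcd : d * c ≤ 1 / 2 := by
    calc d * c ≤ d * (1 / (2 * (d : ℝ))) := by gcongr; exact min_le_right _ _
      _ = 1 / 2 := by field_simp
  have hn : (2 : ℝ) ≤ (hits S R).card := by exact_mod_cast h2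
  by_contra hno
  have hq : ∀ i : Fin d, ∃ v : Fin k,
      (((hits S R).filter fun z => z i ≠ v).card : ℝ) < c * (hits S R).card := by
    intro i
    obtain ⟨y, -, hy1, hy2⟩ := exists_quantile (hits S R) (Finset.card_pos.mp (by omega))
      (fun z => z i) (c * (hits S R).card) (by positivity) (by nlinarith)
    refine ⟨y i, ?_⟩
    rcases exists_gridCut_or_card_ne_lt hR h2 i (y i) hc0 hc1 hy1 (by nlinarith) with h | h
    · obtain ⟨Q, -, hQ⟩ := h
      exact absurd ⟨Q, hQ⟩ hno
    · exact h
  choose v hv using hq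
  have := card_lt_of_card_ne_lt hd (hits S R) v _ hv
  nlinarith

theorem exists_balancedPartsFindable_subgrids {d : ℕ} (hd : 1 ≤ d) :
    ∃ c C : ℝ, (0 < c ∧ c < 1) ∧ ∀ k : ℕ, BalancedPartsFindable (subgrids d k) c C := by
  classical
  have hd' : (1 : ℝ) ≤ d := by exact_mod_cast hd
  set s : ℝ := 1 / (4 * d) with hs
  have hs0 : 0 < s := by positivity
  have hsd : s * d = 1 / 4 := by
    rw [hs]
    field_simp
  have hs1 : s ≤ 1 / 4 := by nlinarith
  obtain ⟨C, hC⟩ := exists_balancedPartsFindable s 1 (1 / 2) hs0 (by linarith) one_pos le_rfl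
    (by norm_num) (by norm_num) (d * 3)
  refine ⟨s / 2, C, ⟨by positivity, by linarith⟩, fun k => hC (subgrids d k)
    (fun R _ y => (List.finRange d).flatMap fun i => gridCuts R i (y i)) ?_ ?_⟩
  · intro R x y
    simp [gridCuts, List.length_flatMap]
  · intro S R hR h2
    refine ⟨hits S R, subset_rfl, by simp, fun x _ => ?_⟩
    obtain ⟨Y, hYs, hmid, hY⟩ :=
      card_middle_ge (hits S R) (fun (i : Fin d) z => z i) s hs0.le
    rw [Fintype.card_fin, mul_assoc, hsd] at hmid
    refine ⟨Y, hYs, le_trans (le_of_eq (by norm_num)) hmid, fun y hy => ?_⟩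
    by_contra hno
    have hne : ∀ i, (((hits S R).filter fun z => z i ≠ y i).card : ℝ) < s * (hits S R).card := by
      intro i
      refine (exists_gridCut_or_card_ne_lt hR h2 i (y i) hs0 (by linarith) (hY y hy i).1
        (hY y hy i).2).resolve_left ?_
      rintro ⟨Q, hQ, hbal⟩
      exact hno ⟨Q, List.mem_flatMap.mpr ⟨i, List.mem_finRange i, hQ⟩, hbal⟩
    have := card_lt_of_card_ne_lt hd (hits S R) y _ hne
    have hn : (2 : ℝ) ≤ (hits S R).card := by exact_mod_cast h2
    nlinarith

theorem univ_mem_subgrids {d k : ℕ} (hk : 1 ≤ k) : Finset.univ ∈ subgrids d k := by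
  obtain ⟨k, rfl⟩ := Nat.exists_eq_add_of_le' hk
  exact ⟨⊥, ⊤, bot_le, by simp⟩

/-! ### Hypercubes -/

/-- The points of `R` that agree with `x` in the first `j` coordinates. -/
def prefixCube {d : ℕ} (R : Finset (Fin d → Bool)) (x : Fin d → Bool) (j : ℕ) :
    Finset (Fin d → Bool) :=
  R.filter fun z => ∀ i : Fin d, i.val < j → z i = x i

theorem mem_prefixCube {d : ℕ} {R : Finset (Fin d → Bool)} {x z : Fin d → Bool} {j : ℕ} :
    z ∈ prefixCube R x j ↔ z ∈ R ∧ ∀ i : Fin d, i.val < j → z i = x i := by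
  simp [prefixCube]

theorem prefixCube_mem_subcubes {d : ℕ} {R : Finset (Fin d → Bool)} (hR : R ∈ subcubes d)
    {x : Fin d → Bool} (hx : x ∈ R) (j : ℕ) : prefixCube R x j ∈ subcubes d := by
  obtain ⟨I, v, rfl⟩ := hR
  refine ⟨I ∪ Finset.univ.filter fun i => i.val < j, x, ?_⟩
  simp only [Finset.mem_filter, Finset.mem_univ, true_and] at hx
  ext z
  simp only [mem_prefixCube, Finset.mem_filter, Finset.mem_univ, true_and, Finset.mem_union]
  constructor
  · rintro ⟨h1, h2⟩ i (hi | hi)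
    · rw [h1 i hi, hx i hi]
    · exact h2 i hi
  · intro h
    exact ⟨fun i hi => by rw [h i (Or.inl hi), hx i hi], fun i hi => h i (Or.inr hi)⟩

theorem prefixCube_subset {d : ℕ} (R : Finset (Fin d → Bool)) (x : Fin d → Bool) {j j' : ℕ}
    (h : j ≤ j') : prefixCube R x j' ⊆ prefixCube R x j := fun z hz => by
  rw [mem_prefixCube] at *
  exact ⟨hz.1, fun i hi => hz.2 i (hi.trans_le h)⟩

theorem prefixCube_eq {d : ℕ} {R : Finset (Fin d → Bool)} {x v : Fin d → Bool} {j : ℕ}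
    (h : x ∈ prefixCube R v j) : prefixCube R x j = prefixCube R v j := by
  ext z
  rw [mem_prefixCube] at h
  rw [mem_prefixCube, mem_prefixCube]
  refine and_congr_right fun _ => forall₂_congr fun i hi => ?_
  rw [h.2 i hi]

/-- Fixing the coordinates one after the other to the value taken by the majority of the
remaining points leads to a balanced part. -/
theorem exists_prefixCube_card {d : ℕ} {S R : Finset (Fin d → Bool)} (h2 : 2 ≤ (hits S R).card) :
    ∃ j ≤ d, ∃ v ∈ R, 1 / 3 * ((hits S R).card : ℝ) ≤ (hits S (prefixCube R v j)).card ∧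
      ((hits S (prefixCube R v j)).card : ℝ) ≤ (1 - 1 / 3) * (hits S R).card := by
  classical
  have hn : (2 : ℝ) ≤ (hits S R).card := by exact_mod_cast h2
  by_contra hno
  push Not at hno
  have hbig : ∀ j ≤ d, ∃ v ∈ R,
      (1 - 1 / 3) * ((hits S R).card : ℝ) < (hits S (prefixCube R v j)).card := by
    intro j
    induction j with
    | zero =>
      intro _
      obtain ⟨v, hv⟩ := Finset.card_pos.mp (by omega : 0 < (hits S R).card)
      refine ⟨v, (mem_hits.mp hv).1, ?_⟩
      have : prefixCube R v 0 = R := by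
        ext z
        simp [mem_prefixCube]
      rw [this]
      linarith
    | succ j ih =>
      intro hj
      obtain ⟨v, hv, hcard⟩ := ih (by omega)
      set A := hits S (prefixCube R v j) with hA
      let i : Fin d := ⟨j, hj⟩
      have hsplit : ((A.filter fun z => z i = true).card : ℝ) + (A.filter fun z => z i = false).card
          = A.card := by
        have := A.card_filter_add_card_filter_not (fun z => z i = true)
        simp only [Bool.not_eq_true] at this
        exact_mod_cast this
      have hhalf : ∃ b, 1 / 3 * ((hits S R).card : ℝ) < (A.filter fun z => z i = b).card := by
        by_contra h
        push Not at h
        linarith [h true, h false]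
      obtain ⟨b, hb⟩ := hhalf
      have h0 : 0 < (A.filter fun z => z i = b).card := by
        have : (0 : ℝ) < (A.filter fun z => z i = b).card := by linarith
        exact_mod_cast this
      obtain ⟨w, hw⟩ := Finset.card_pos.mp h0
      obtain ⟨hwA, hwb⟩ := Finset.mem_filter.mp hw
      have hwv := (mem_hits.mp hwA).1
      have hwR := (mem_prefixCube.mp hwv).1
      have hle : (A.filter fun z => z i = b).card ≤ (hits S (prefixCube R w (j + 1))).card := by
        refine Finset.card_le_card fun z hz => ?_
        obtain ⟨hzA, hzb⟩ := Finset.mem_filter.mp hz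
        obtain ⟨hzv, hzS⟩ := mem_hits.mp hzA
        rw [← prefixCube_eq hwv, mem_prefixCube] at hzv
        refine mem_hits.mpr ⟨mem_prefixCube.mpr ⟨hzv.1, fun i' hi' => ?_⟩, hzS⟩
        rcases Nat.lt_succ_iff_lt_or_eq.mp hi' with h | h
        · exact hzv.2 i' h
        · have : i' = i := Fin.ext h
          rw [this, hzb, hwb]
      have hle' : ((A.filter fun z => z i = b).card : ℝ)
          ≤ (hits S (prefixCube R w (j + 1))).card := by exact_mod_cast hle
      exact ⟨w, hwR, hno (j + 1) hj w hwR (by linarith)⟩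
  obtain ⟨v, -, hv⟩ := hbig d le_rfl
  have hone : (hits S (prefixCube R v d)).card ≤ 1 := by
    refine Finset.card_le_one.mpr fun x hx y hy => ?_
    rw [mem_hits, mem_prefixCube] at hx hy
    funext i
    rw [hx.1.2 i i.isLt, hy.1.2 i i.isLt]
  have : ((hits S (prefixCube R v d)).card : ℝ) ≤ 1 := by exact_mod_cast hone
  linarith

theorem hasBalancedParts_subcubes (d : ℕ) : HasBalancedParts (subcubes d) (1 / 3) := by
  intro S R hR h2
  obtain ⟨j, -, v, hv, h⟩ := exists_prefixCube_card h2
  exact ⟨prefixCube R v j, isBalancedPart_of_card (by norm_num) h2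
    (prefixCube_mem_subcubes hR hv j) (Finset.filter_subset _ _) h.1 h.2⟩

/-- The number of leading coordinates in which two points agree. -/
def agreement {d : ℕ} (x z : Fin d → Bool) : ℕ :=
  Nat.findGreatest (fun j => ∀ i : Fin d, i.val < j → z i = x i) d

theorem le_agreement_iff {d : ℕ} {x z : Fin d → Bool} {j : ℕ} (hj : j ≤ d) :
    j ≤ agreement x z ↔ ∀ i : Fin d, i.val < j → z i = x i := by
  constructor
  · intro h i hi
    have := Nat.findGreatest_spec (P := fun j => ∀ i : Fin d, i.val < j → z i = x i)
      (Nat.zero_le d) (fun i hi => absurd hi (Nat.not_lt_zero _))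
    exact this i (hi.trans_le h)
  · intro h
    exact Nat.le_findGreatest hj h

theorem prefixCube_eq_filter {d : ℕ} (R : Finset (Fin d → Bool)) (x : Fin d → Bool) {j : ℕ}
    (hj : j ≤ d) : prefixCube R x j = R.filter fun z => j ≤ agreement x z := by
  simp only [prefixCube, le_agreement_iff hj]

theorem exists_balancedPartsFindable_subcubes :
    ∃ c C : ℝ, (0 < c ∧ c < 1) ∧ ∀ d : ℕ, BalancedPartsFindable (subcubes d) c C := by
  classical
  obtain ⟨C, hC⟩ := exists_balancedPartsFindable (1 / 4) (1 / 3) (1 / 2) (by norm_num) (by norm_num)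
    (by norm_num) (by norm_num) (by norm_num) (by norm_num) 2
  refine ⟨1 / 4 / 2, C, by norm_num, fun d => hC (subcubes d) (fun R x y =>
    [prefixCube R x (agreement x y), prefixCube R x (agreement x y + 1)]) (fun _ _ _ => le_rfl) ?_⟩
  intro S R hR h2
  have hn : (2 : ℝ) ≤ (hits S R).card := by exact_mod_cast h2
  obtain ⟨J, hJ, v, hv, hJ1, hJ2⟩ := exists_prefixCube_card h2
  refine ⟨hits S (prefixCube R v J), hits_subset S (Finset.filter_subset _ _), hJ1, fun x hx => ?_⟩
  have hxv := (mem_hits.mp hx).1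
  have hxR := (mem_prefixCube.mp hxv).1
  rw [← prefixCube_eq hxv] at hJ1 hJ2
  -- The sets of points that agree with `x` at least as long as `y` does form a chain, which contains
  -- the balanced sub-cube, so that it cannot jump over the balanced range.
  obtain ⟨Y, hYs, hmid, hY⟩ := card_middle_ge (κ := Unit) (hits S R)
    (fun _ z => OrderDual.toDual (agreement x z)) (1 / 4) (by norm_num)
  refine ⟨Y, hYs, le_trans (le_of_eq (by norm_num)) hmid, fun y hy => ?_⟩
  obtain ⟨hy1, hy2⟩ := hY y hy ()
  simp only [OrderDual.toDual_le_toDual, OrderDual.toDual_lt_toDual] at hy1 hy2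
  have hjd : agreement x y ≤ d := Nat.findGreatest_le d
  replace hy1 : 1 / 4 * ((hits S R).card : ℝ)
      ≤ (hits S (prefixCube R x (agreement x y))).card := by
    rw [prefixCube_eq_filter R x hjd, hits_filter]
    convert hy1
  by_cases h : ((hits S (prefixCube R x (agreement x y))).card : ℝ)
      ≤ (1 - 1 / 4) * (hits S R).card
  · exact ⟨_, by simp, isBalancedPart_of_card (by norm_num) h2 (prefixCube_mem_subcubes hR hxR _)
      (Finset.filter_subset _ _) hy1 h⟩
  · have hlt : agreement x y < J := by
      by_contra hge
      have : ((hits S (prefixCube R x (agreement x y))).card : ℝ)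
          ≤ (hits S (prefixCube R x J)).card := by
        exact_mod_cast Finset.card_le_card
          (hits_subset S (prefixCube_subset R x (not_lt.mp hge)))
      apply h
      linarith
    replace hy2 : ((hits S (prefixCube R x (agreement x y + 1))).card : ℝ)
        ≤ (1 - 1 / 4) * (hits S R).card := by
      rw [prefixCube_eq_filter R x (by omega), hits_filter]
      convert hy2
      exact Nat.succ_le_iff
    have hge : ((hits S (prefixCube R x J)).card : ℝ)
        ≤ (hits S (prefixCube R x (agreement x y + 1))).card := by
      exact_mod_cast Finset.card_le_card (hits_subset S (prefixCube_subset R x hlt))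
    exact ⟨_, by simp, isBalancedPart_of_card (by norm_num) h2 (prefixCube_mem_subcubes hR hxR _)
      (Finset.filter_subset _ _) (by linarith) hy2⟩

theorem univ_mem_subcubes (d : ℕ) : Finset.univ ∈ subcubes d := ⟨∅, fun _ => true, by simp⟩

/-! ### Estimating the size of the hidden set -/

namespace SamplingAlg

variable {U : Type} {F G : Set (Finset U)} {O O' : Type}

theorem run_weaken (h : F ⊆ G) (S : Finset U) (A : SamplingAlg F O) :
    (A.weaken h).run S = A.run S := by
  induction A with
  | done o => rfl
  | sample T hT next ih => simp only [weaken, run, ih]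
  | coin next ih => simp only [weaken, run, ih]

open Classical in
/-- If `T ∩ S` has at least two points, then many samples are rarely all equal. -/
theorem expect_draw_all_eq_le (S T : Finset U) (hT : T ∈ F) (h2 : 2 ≤ (hits S T).card) (n : ℕ) :
    (draw T hT (n + 1)).expect S (fun l _ => if ∃ a, ∀ b ∈ l, b = a then (1 : ℝ) else 0)
      ≤ (1 / 2) ^ n := by
  have hne : (hits S T).Nonempty := Finset.card_pos.mp (by omega)
  have hn : (2 : ℝ) ≤ (hits S T).card := by exact_mod_cast h2
  rw [expect_draw_succ, ← sampleMean_const (S := S) (T := T) ((1 / 2) ^ n)]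
  refine sampleMean_mono fun a => ?_
  have hprod : ∀ l : List (Option U), (if ∃ a', ∀ b ∈ a :: l, b = a' then (1 : ℝ) else 0)
      = (l.map fun b => if b = a then (1 : ℝ) else 0).prod := by
    intro l
    have : (∃ a', ∀ b ∈ a :: l, b = a') ↔ ∀ b ∈ l, b = a := by
      simp only [List.mem_cons, forall_eq_or_imp]
      exact ⟨fun ⟨a', h, h'⟩ => h ▸ h', fun h => ⟨a, rfl, h⟩⟩
    rw [if_congr this rfl rfl]
    clear this
    induction l with
    | nil => simp
    | cons b l ih =>
      rw [List.map_cons, List.prod_cons, ← ih]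
      by_cases hb : b = a <;> simp [hb]
  simp only [hprod, expect_draw_prod]
  have h0 : 0 ≤ sampleMean S T fun b => if b = a then (1 : ℝ) else 0 := by
    refine (sampleMean_const (S := S) (T := T) 0).symm.le.trans (sampleMean_mono fun b => ?_)
    split_ifs <;> norm_num
  gcongr
  rw [sampleMean_of_nonempty hne, Finset.sum_boole, div_le_iff₀ (by linarith)]
  have : ((hits S T).filter fun x => some x = a).card ≤ 1 := by
    refine Finset.card_le_one.mpr fun x hx y hy => Option.some_injective _ ?_
    rw [(Finset.mem_filter.mp hx).2, (Finset.mem_filter.mp hy).2]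
  have : (((hits S T).filter fun x => some x = a).card : ℝ) ≤ 1 := by exact_mod_cast this
  linarith

open Classical in
/-- The estimate for `1 / |R ∩ S|`, on level `j` of the recursion. A few samples decide whether
`R ∩ S` has at most one point. Otherwise a balanced part `R'` of `R` is looked for, the fraction of
`R ∩ S` that lies in `R'` is estimated by an empirical frequency, and `1 / |R' ∩ S|` is
estimated recursively. The first argument bounds the depth of the recursion. -/
noncomputable def estimate (find : ℕ → ∀ R, R ∈ F → SamplingAlg F (Finset U)) (t N : ℕ → ℕ) :
    ℕ → ℕ → (R : Finset U) → R ∈ F → SamplingAlg F ℝ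
  | 0, _, _, _ => .done 0
  | n + 1, j, R, hR => (draw R hR (t j)).bind fun l =>
      if none ∈ l then .done 0
      else if ∃ a, ∀ b ∈ l, b = a then .done 1
      else (find j R hR).bind fun R' =>
        if h : R' ∈ F ∧ R' ⊂ R then
          (draw R hR (N j)).bind fun l' => (estimate find t N n (j + 1) R' h.1).bind fun X =>
            .done ((l'.map (answerIn R')).sum / N j * X)
        else .done 0

theorem none_notMem_of_isAnswer {S R : Finset U} (hn : (hits S R).Nonempty)
    {l : List (Option U)} (hl : ∀ a ∈ l, IsAnswer S R a) : none ∉ l := fun h => by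
  obtain ⟨x, -, hx⟩ := (hl none h).1 hn
  cases hx

theorem all_eq_of_isAnswer {S R : Finset U} (hn : (hits S R).card = 1)
    {l : List (Option U)} (hl : ∀ a ∈ l, IsAnswer S R a) : ∃ a, ∀ b ∈ l, b = a := by
  obtain ⟨x, hx⟩ := Finset.card_eq_one.mp hn
  refine ⟨some x, fun b hb => ?_⟩
  obtain ⟨y, hy, rfl⟩ := (hl b hb).1 ⟨x, by simp [hx]⟩
  rw [hx, Finset.mem_singleton] at hy
  rw [hy]

theorem none_mem_of_isAnswer {S R : Finset U} (hn : ¬ (hits S R).Nonempty)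
    {l : List (Option U)} (h0 : l ≠ []) (hl : ∀ a ∈ l, IsAnswer S R a) : none ∈ l := by
  obtain ⟨a, ha⟩ := List.exists_mem_of_ne_nil l h0
  rwa [← (hl a ha).2 hn]

/-- The relative variance of the empirical frequency `p̂` of a part of density `p ≥ c` is at most
`1 / (c N)`. -/
theorem expect_frequency_quadratic {S R Q : Finset U} (hR : R ∈ F) (hn : (hits S R).Nonempty)
    (hQ : Q ⊆ R) {c : ℝ} (hc : 0 < c) (hcQ : c * (hits S R).card ≤ (hits S Q).card) {N : ℕ}
    (hN : 0 < N) (V τ : ℝ) (hV : 0 ≤ V) :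
    (draw R hR N).expect S (fun l _ =>
        V * (τ * (hits S R).card / (hits S Q).card * ((l.map (answerIn Q)).sum / N)) ^ 2
          - 2 * (τ * (hits S R).card / (hits S Q).card * ((l.map (answerIn Q)).sum / N)) + 1)
      ≤ (1 + 1 / (c * N)) * V * τ ^ 2 - 2 * τ + 1 := by
  have hpos : (0 : ℝ) < (hits S R).card := by exact_mod_cast hn.card_pos
  have hposQ : (0 : ℝ) < (hits S Q).card := (mul_pos hc hpos).trans_le hcQ
  have hN' : (0 : ℝ) < N := by exact_mod_cast hN
  set p : ℝ := (hits S Q).card / (hits S R).card with hp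
  have hp0 : 0 < p := by positivity
  have hcp : c ≤ p := (le_div_iff₀ hpos).mpr hcQ
  have hscale : τ * (hits S R).card / (hits S Q).card = τ / p := by
    rw [hp]
    field_simp
  have hmean := sampleMean_answerIn hn hQ
  have h1 := expect_draw_sum S R hR N (answerIn Q)
  have h2 := expect_draw_sum_sq S R hR N (answerIn Q)
  simp only [answerIn_sq] at h2
  rw [hmean, ← hp] at h1 h2
  have hlin : ∀ l : List (Option U),
      V * (τ / p * ((l.map (answerIn Q)).sum / N)) ^ 2
          - 2 * (τ / p * ((l.map (answerIn Q)).sum / N)) + 1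
        = (V * (τ / p) ^ 2 / N ^ 2 * (l.map (answerIn Q)).sum ^ 2
          + -(2 * (τ / p) / N) * (l.map (answerIn Q)).sum) + 1 := fun l => by
    field_simp
    ring
  simp only [hscale, hlin]
  rw [expect_add, expect_const, expect_add, expect_mul_left, expect_mul_left, h1, h2]
  have e1 : -(2 * (τ / p) / N) * (N * p) = - (2 * τ) := by field_simp
  have e2 : V * (τ / p) ^ 2 / N ^ 2 * (N * p + N * (N - 1) * p ^ 2)
      = V * τ ^ 2 * (1 + 1 / (p * N) - 1 / N) := by
    field_simp
    ring
  have e3 : 1 / (p * N) ≤ 1 / (c * N) := by gcongr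
  have e4 : 0 ≤ 1 / (N : ℝ) := by positivity
  have e5 : V * τ ^ 2 * (1 + 1 / (p * N) - 1 / N) ≤ V * τ ^ 2 * (1 + 1 / (c * N)) := by
    gcongr
    linarith
  rw [e1, e2]
  linarith

section estimate

variable {find : ℕ → ∀ R, R ∈ F → SamplingAlg F (Finset U)} {t N : ℕ → ℕ} {S : Finset U} {c : ℝ}
  {δ : ℕ → ℝ}

open Classical in
/-- The error of the estimate `X` for `1 / |R ∩ S|`. The bound is the sum of the failure
probabilities of all tests, and of Chebyshev's bound for the product of the empirical frequencies.
For the induction it is stated for all factors `τ`, which stand for the frequencies found on the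
levels above. -/
theorem expect_estimate_error (hc : 0 < c)
    (hfind : ∀ j R hR, 2 ≤ (hits S R).card → (find j R hR).expect S
      (fun Q _ => if IsBalancedPart F c S R Q then 0 else 1) ≤ δ j)
    (hδ : ∀ j, 0 ≤ δ j)
    {D V : ℕ → ℝ} {η : ℝ} (hη : 0 < η) (hN : ∀ j, 0 < N j) (hD0 : ∀ j, 0 ≤ D j)
    (hD : ∀ j, (1 / 2) ^ (t j) + δ j + D (j + 1) ≤ D j) (hV1 : ∀ j, 1 ≤ V j)
    (hV : ∀ j, (1 + 1 / (c * N j)) * V (j + 1) ≤ V j) (n j : ℕ) (R : Finset U) (hR : R ∈ F)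
    (hne : (hits S R).Nonempty) (hn : R.card < n) (τ : ℝ) :
    (estimate find (fun j => t j + 1) N n j R hR).expect S
        (fun X _ => if η < |τ * (hits S R).card * X - 1| then 1 else 0)
      ≤ D j + (V j * τ ^ 2 - 2 * τ + 1) / η ^ 2 := by
  induction n generalizing j R τ with
  | zero => omega
  | succ n ih =>
  have hquad : ∀ (j : ℕ) (τ : ℝ), 0 ≤ (V j * τ ^ 2 - 2 * τ + 1) / η ^ 2 := fun j τ => by
    have : 0 ≤ V j * τ ^ 2 - 2 * τ + 1 := by nlinarith [sq_nonneg (τ - 1), hV1 j, sq_nonneg τ]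
    positivity
  simp only [estimate, expect_bind]
  rcases Nat.lt_or_ge (hits S R).card 2 with h1 | h2
  · have hone : (hits S R).card = 1 := by
      have := hne.card_pos
      omega
    rw [← expect_const S (draw R hR (t j + 1)) (D j + _)]
    refine expect_draw_mono fun l _ hl => ?_
    rw [if_neg (none_notMem_of_isAnswer hne hl), if_pos (all_eq_of_isAnswer hone hl), hone]
    simp only [expect, Nat.cast_one, mul_one]
    split_ifs with h
    · have h3 : 1 ≤ (V j * τ ^ 2 - 2 * τ + 1) / η ^ 2 := by
        rw [le_div_iff₀ (by positivity)]
        have : η ^ 2 < (τ - 1) ^ 2 := by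
          rw [← sq_abs (τ - 1)]
          gcongr
        nlinarith [hV1 j, sq_nonneg τ]
      linarith [hD0 j]
    · linarith [hquad j τ, hD0 j]
  · set B : ℝ := δ j + (D (j + 1) + (V j * τ ^ 2 - 2 * τ + 1) / η ^ 2) with hB
    calc _ ≤ (draw R hR (t j + 1)).expect S (fun l _ =>
          (if ∃ a, ∀ b ∈ l, b = a then (1 : ℝ) else 0) + B) := by
          refine expect_draw_mono fun l _ hl => ?_
          rw [if_neg (none_notMem_of_isAnswer hne hl)]
          by_cases hall : ∃ a, ∀ b ∈ l, b = a
          · rw [if_pos hall, if_pos hall]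
            simp only [expect]
            have : 0 ≤ B := by
              rw [hB]
              linarith [hδ j, hD0 (j + 1), hquad j τ]
            split_ifs <;> linarith
          rw [if_neg hall, if_neg hall, zero_add]
          simp only [expect_bind]
          calc _ ≤ (find j R hR).expect S (fun Q _ =>
                (if IsBalancedPart F c S R Q then 0 else 1)
                  + (D (j + 1) + (V j * τ ^ 2 - 2 * τ + 1) / η ^ 2)) := by
                refine expect_mono fun Q _ => ?_
                by_cases hQ : IsBalancedPart F c S R Q
                swap
                · rw [if_neg hQ]
                  have h0 : 0 ≤ D (j + 1) + (V j * τ ^ 2 - 2 * τ + 1) / η ^ 2 := by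
                    linarith [hD0 (j + 1), hquad j τ]
                  refine le_trans (expect_mono (g := fun _ _ => 1) fun X _ => ?_) ?_
                  · split_ifs <;> norm_num
                  · rw [expect_const]
                    linarith
                obtain ⟨hQF, hQR, hQ1, -⟩ := id hQ
                change c * ((hits S R).card : ℝ) ≤ (hits S Q).card at hQ1
                have hpos : (0 : ℝ) < (hits S R).card := by exact_mod_cast hne.card_pos
                have hposQ : (0 : ℝ) < (hits S Q).card := (mul_pos hc hpos).trans_le hQ1
                rw [if_pos hQ, zero_add, dif_pos ⟨hQF, hQR⟩]
                simp only [expect_bind, expect]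
                calc _ ≤ (draw R hR (N j)).expect S (fun l' _ => D (j + 1) + 1 / η ^ 2 *
                      (V (j + 1) * (τ * (hits S R).card / (hits S Q).card
                          * ((l'.map (answerIn Q)).sum / N j)) ^ 2
                        - 2 * (τ * (hits S R).card / (hits S Q).card
                          * ((l'.map (answerIn Q)).sum / N j)) + 1)) := by
                      refine expect_mono fun l' _ => ?_
                      -- The factor `τ` of the next level contains the frequency found on this one.
                      have := ih (j + 1) Q hQF
                        (Finset.card_pos.mp (by exact_mod_cast hposQ))
                        (by have := Finset.card_lt_card hQR; omega)
                        (τ * (hits S R).card / (hits S Q).card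
                          * ((l'.map (answerIn Q)).sum / N j))
                      have hscale : ∀ X : ℝ, τ * (hits S R).card / (hits S Q).card
                          * ((l'.map (answerIn Q)).sum / N j) * (hits S Q).card * X
                          = τ * (hits S R).card * ((l'.map (answerIn Q)).sum / N j * X) :=
                        fun X => by field_simp
                      simp only [hscale] at this
                      refine this.trans (le_of_eq ?_)
                      ring
                  _ ≤ _ := by
                      rw [expect_add, expect_const, expect_mul_left]
                      have h3 := expect_frequency_quadratic hR hne hQR.subset hc hQ1 (hN j)
                        (V (j + 1)) τ (by linarith [hV1 (j + 1)])
                      have h4 : (1 + 1 / (c * N j)) * V (j + 1) * τ ^ 2 ≤ V j * τ ^ 2 := by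
                        gcongr
                        exact hV j
                      have h5 : 0 ≤ 1 / η ^ 2 := by positivity
                      have h6 := mul_le_mul_of_nonneg_left
                        (h3.trans (sub_le_sub_right h4 (2 * τ) |> (add_le_add_left · 1))) h5
                      rw [one_div_mul_eq_div (η ^ 2) (V j * τ ^ 2 - 2 * τ + 1)] at h6
                      linarith
            _ ≤ _ := by
                rw [expect_add, expect_const]
                linarith [hfind j R hR h2]
      _ ≤ _ := by
          rw [expect_add, expect_const]
          have := expect_draw_all_eq_le S R hR h2 (t j)
          linarith [hD j]

/-- One level of the recursion for the exponential moments of the number of samples: `M` bounds the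
moments of the next level after a balanced part has been found, and `B` bounds them in any case. -/
theorem expect_exp_cost_succ {K : ℕ → ℝ} {θ : ℝ} (hθ : 0 ≤ θ)
    (hfind : ∀ j R hR, 2 ≤ (hits S R).card → (find j R hR).expect S
      (open Classical in fun Q _ => if IsBalancedPart F c S R Q then 0 else 1) ≤ δ j)
    (hδ : ∀ j, 0 ≤ δ j)
    (hK0 : ∀ j, 0 ≤ K j)
    (hK : ∀ j R hR, ∀ x ∈ ((find j R hR).run S).support, (x.2 : ℝ) ≤ K j) {n j : ℕ} {a : ℝ}
    (ha : θ * ((t j + 1 : ℕ) + K j + N j) ≤ a) (R : Finset U) (hR : R ∈ F) {M B : ℝ} (hM : 1 ≤ M)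
    (hB : 1 ≤ B)
    (hBR : ∀ R' (hR' : R' ∈ F), R' ⊂ R →
      (estimate find (fun j => t j + 1) N n (j + 1) R' hR').expect S
        (fun _ m => Real.exp (θ * m)) ≤ B)
    (hMR : 2 ≤ (hits S R).card → ∀ R' (hR' : R' ∈ F), IsBalancedPart F c S R R' →
      (estimate find (fun j => t j + 1) N n (j + 1) R' hR').expect S
        (fun _ m => Real.exp (θ * m)) ≤ M) :
    (estimate find (fun j => t j + 1) N (n + 1) j R hR).expect S (fun _ m => Real.exp (θ * m))
      ≤ Real.exp a * (M + δ j * B) := by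
  classical
  simp only [estimate, expect_bind]
  rw [← expect_const S (draw R hR (t j + 1)) (Real.exp a * (M + δ j * B))]
  refine expect_draw_mono fun l hlen hl => ?_
  have hδB : 0 ≤ δ j * B := mul_nonneg (hδ j) (by linarith)
  have hN0 : (0 : ℝ) ≤ N j := Nat.cast_nonneg _
  have hexp : ∀ {x y : ℝ}, x ≤ (t j + 1 : ℕ) + K j + N j → 1 ≤ y →
      Real.exp (θ * x) ≤ Real.exp a * y := fun {x y} hx hy => by
    have h1 : Real.exp (θ * x) ≤ Real.exp a :=
      Real.exp_le_exp.mpr ((mul_le_mul_of_nonneg_left hx hθ).trans ha)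
    nlinarith [Real.exp_pos a]
  by_cases hnone : none ∈ l
  · rw [if_pos hnone]
    exact hexp (by push_cast; linarith [hK0 j]) (by linarith)
  by_cases hall : ∃ a, ∀ b ∈ l, b = a
  · rw [if_neg hnone, if_pos hall]
    exact hexp (by push_cast; linarith [hK0 j]) (by linarith)
  have h2 : 2 ≤ (hits S R).card := by
    by_contra hlt
    rcases Nat.lt_or_ge (hits S R).card 1 with h | h
    · refine hnone (none_mem_of_isAnswer ?_ ?_ hl)
      · rw [← Finset.card_pos]
        omega
      · rintro rfl
        simp at hlen
    · exact hall (all_eq_of_isAnswer (by omega) hl)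
  rw [if_neg hnone, if_neg hall]
  simp only [expect_bind]
  calc _ ≤ (find j R hR).expect S (fun Q _ => Real.exp a * M + Real.exp a * B *
        (if IsBalancedPart F c S R Q then 0 else 1)) := by
        refine expect_mono_of_support fun x hx => ?_
        have hxK := hK j R hR x hx
        have hxM : Real.exp a * (if IsBalancedPart F c S R x.1 then M else B) ≤
            Real.exp a * M + Real.exp a * B * (if IsBalancedPart F c S R x.1 then 0 else 1) := by
          split_ifs
          · linarith
          · nlinarith [Real.exp_pos a]
        refine le_trans ?_ hxM
        by_cases hQ : x.1 ∈ F ∧ x.1 ⊂ R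
        swap
        · rw [dif_neg hQ]
          exact hexp (by push_cast; linarith) (by split_ifs <;> assumption)
        rw [dif_pos hQ]
        simp only [expect_bind, expect]
        rw [← expect_const S (draw R hR (N j)) (Real.exp a * _)]
        refine expect_draw_mono fun l' _ _ => ?_
        have hrec : (estimate find (fun j => t j + 1) N n (j + 1) x.1 hQ.1).expect S
            (fun _ m => Real.exp (θ * m)) ≤ if IsBalancedPart F c S R x.1 then M else B := by
          split_ifs with hbal
          · exact hMR h2 _ _ hbal
          · exact hBR _ _ hQ.2
        calc _ ≤ (estimate find (fun j => t j + 1) N n (j + 1) x.1 hQ.1).expect S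
              (fun _ m => Real.exp a * Real.exp (θ * m)) := by
              refine expect_mono fun _ m => ?_
              rw [← Real.exp_add]
              apply Real.exp_le_exp.mpr
              have h3 : θ * ((t j + 1 : ℕ) + x.2 + N j) ≤ a :=
                le_trans (by gcongr) ha
              push_cast at h3 ⊢
              linarith
          _ ≤ _ := by
              rw [expect_mul_left]
              gcongr
    _ ≤ _ := by
        rw [expect_add, expect_const, expect_mul_left]
        have := hfind j R hR h2
        have hpos : 0 ≤ Real.exp a * B := by positivity
        nlinarith

/-- Exponential moments of the number of samples, from a level `j` on which the failure
probability is small enough to absorb the cost of the `l ≤ j` levels that are still needed. -/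
theorem expect_exp_cost_le_of_le {K : ℕ → ℝ} {θ : ℝ} (hθ : 0 ≤ θ) (hc1 : c < 1)
    (hfind : ∀ j R hR, 2 ≤ (hits S R).card → (find j R hR).expect S
      (open Classical in fun Q _ => if IsBalancedPart F c S R Q then 0 else 1)
        ≤ Real.exp (-(12 * ((j : ℝ) + 1) ^ 2)))
    (hK0 : ∀ j, 0 ≤ K j)
    (hK : ∀ j R hR, ∀ x ∈ ((find j R hR).run S).support, (x.2 : ℝ) ≤ K j)
    (ha : ∀ j, θ * ((t j + 1 : ℕ) + K j + N j) ≤ ((j : ℝ) + 1) ^ 2) (n j l : ℕ) (R : Finset U)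
    (hR : R ∈ F) (hlj : l ≤ j) (hl : ((hits S R).card : ℝ) ≤ (1 - c)⁻¹ ^ l) :
    (estimate find (fun j => t j + 1) N n j R hR).expect S (fun _ m => Real.exp (θ * m))
      ≤ Real.exp (2 * ((l : ℝ) + 1) * ((j : ℝ) + l + 2) ^ 2) := by
  induction n generalizing j l R with
  | zero =>
    simp only [estimate, expect, Nat.cast_zero, mul_zero, Real.exp_zero, Real.one_le_exp_iff]
    positivity
  | succ n ih =>
    have hcpos : 0 < 1 - c := by linarith
    have step := expect_exp_cost_succ hθ hfind (fun _ => (Real.exp_pos _).le) hK0 hK (ha j)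
      (n := n) (j := j) R hR
      (M := Real.exp (2 * (l : ℝ) * ((j : ℝ) + l + 2) ^ 2))
      (B := Real.exp (2 * ((l : ℝ) + 1) * (((j + 1 : ℕ) : ℝ) + l + 2) ^ 2))
      (Real.one_le_exp (by positivity)) (Real.one_le_exp (by positivity))
      (fun R' hR' hsub => ih (j + 1) l R' hR' (by omega) (le_trans (by
        exact_mod_cast Finset.card_le_card (hits_subset S hsub.subset)) hl))
      (fun h2 R' hR' hbal => by
        have h2' : (2 : ℝ) ≤ (hits S R).card := by exact_mod_cast h2
        rcases l with - | l
        · rw [pow_zero] at hl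
          linarith
        · have hb : ((hits S R').card : ℝ) ≤ (1 - c) * (hits S R).card := hbal.2.2.2
          have := ih (j + 1) l R' hR' (by omega) (by
            calc ((hits S R').card : ℝ) ≤ (1 - c) * (hits S R).card := hb
              _ ≤ (1 - c) * (1 - c)⁻¹ ^ (l + 1) := by gcongr
              _ = (1 - c)⁻¹ ^ l := by
                rw [pow_succ]
                field_simp)
          refine this.trans (le_of_eq ?_)
          push_cast
          congr 2
          ring)
    refine step.trans ?_
    have hlj' : (l : ℝ) ≤ j := by exact_mod_cast hlj
    have hl0 : (0 : ℝ) ≤ l := Nat.cast_nonneg _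
    rw [mul_add, ← Real.exp_add, ← Real.exp_add, ← Real.exp_add]
    set A : ℝ := 2 * ((l : ℝ) + 1) * ((j : ℝ) + l + 2) ^ 2 with hA
    -- `e1` is the case of a balanced part, with `l - 1` levels left. In the case of a failure, `e2`,
    -- the exponent `12` in the failure probability outweighs the growth of the bound, as `l ≤ j`.
    have e1 : ((j : ℝ) + 1) ^ 2 + 2 * (l : ℝ) * ((j : ℝ) + l + 2) ^ 2 ≤ A - 1 := by
      rw [hA]
      nlinarith
    have e2 : ((j : ℝ) + 1) ^ 2 + (-(12 * ((j : ℝ) + 1) ^ 2)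
        + 2 * ((l : ℝ) + 1) * (((j + 1 : ℕ) : ℝ) + l + 2) ^ 2) ≤ A - 1 := by
      have h3 : 2 * ((l : ℝ) + 1) * (((j + 1 : ℕ) : ℝ) + l + 2) ^ 2
          = A + 2 * (l + 1) * (2 * (j + l) + 5) := by
        rw [hA]
        push_cast
        ring
      have h4 : 2 * ((l : ℝ) + 1) * (2 * (j + l) + 5) ≤ 2 * (j + 1) * (2 * (j + j) + 5) := by
        gcongr
      rw [h3]
      nlinarith
    have e3 : 2 * Real.exp (A - 1) ≤ Real.exp A := by
      have h5 : Real.exp A = Real.exp (A - 1) * Real.exp 1 := by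
        rw [← Real.exp_add]
        congr 1
        ring
      have h6 : (2 : ℝ) ≤ Real.exp 1 := by linarith [Real.add_one_le_exp (1 : ℝ)]
      rw [h5]
      nlinarith [Real.exp_pos (A - 1)]
    linarith [Real.exp_le_exp.mpr e1, Real.exp_le_exp.mpr e2]

/-- Exponential moments of the number of samples of the whole recursion. On the first `L` levels
no progress is taken into account. -/
theorem expect_exp_cost_le {K : ℕ → ℝ} {θ : ℝ} (hθ : 0 ≤ θ) (hc1 : c < 1)
    (hfind : ∀ j R hR, 2 ≤ (hits S R).card → (find j R hR).expect S
      (open Classical in fun Q _ => if IsBalancedPart F c S R Q then 0 else 1)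
        ≤ Real.exp (-(12 * ((j : ℝ) + 1) ^ 2)))
    (hK0 : ∀ j, 0 ≤ K j)
    (hK : ∀ j R hR, ∀ x ∈ ((find j R hR).run S).support, (x.2 : ℝ) ≤ K j)
    (ha : ∀ j, θ * ((t j + 1 : ℕ) + K j + N j) ≤ ((j : ℝ) + 1) ^ 2) (n L : ℕ) (R : Finset U)
    (hR : R ∈ F) (hL : ((hits S R).card : ℝ) ≤ (1 - c)⁻¹ ^ L) :
    (estimate find (fun j => t j + 1) N n 0 R hR).expect S (fun _ m => Real.exp (θ * m))
      ≤ Real.exp (10 * ((L : ℝ) + 1) ^ 3) := by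
  have key : ∀ i ≤ L, ∀ (n : ℕ) (R : Finset U) (hR : R ∈ F),
      ((hits S R).card : ℝ) ≤ (1 - c)⁻¹ ^ L →
      (estimate find (fun j => t j + 1) N n (L - i) R hR).expect S (fun _ m => Real.exp (θ * m))
        ≤ Real.exp (i * (((L : ℝ) + 1) ^ 2 + 1) + 2 * ((L : ℝ) + 1) * ((L : ℝ) + L + 2) ^ 2) := by
    intro i
    induction i with
    | zero =>
      intro _ n R hR hL
      simpa using expect_exp_cost_le_of_le hθ hc1 hfind hK0 hK ha n L L R hR le_rfl hL
    | succ i ih =>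
      intro hi n R hR hL
      rcases n with - | n
      · simp only [estimate, expect, Nat.cast_zero, mul_zero, Real.exp_zero, Real.one_le_exp_iff]
        positivity
      have hj : L - (i + 1) + 1 = L - i := by omega
      set B := Real.exp (i * (((L : ℝ) + 1) ^ 2 + 1)
        + 2 * ((L : ℝ) + 1) * ((L : ℝ) + L + 2) ^ 2) with hB
      have hrec : ∀ R' (hR' : R' ∈ F), R' ⊂ R →
          (estimate find (fun j => t j + 1) N n (L - (i + 1) + 1) R' hR').expect S
            (fun _ m => Real.exp (θ * m)) ≤ B := fun R' hR' hsub => by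
        rw [hj]
        exact ih (by omega) n R' hR' (le_trans (by
          exact_mod_cast Finset.card_le_card (hits_subset S hsub.subset)) hL)
      have hB1 : 1 ≤ B := Real.one_le_exp (by positivity)
      have step := expect_exp_cost_succ hθ hfind (fun _ => (Real.exp_pos _).le) hK0 hK
        (ha (L - (i + 1))) R hR hB1 hB1 hrec (fun _ R' hR' hbal => hrec R' hR' hbal.2.1)
      refine step.trans ?_
      have h1 : Real.exp (-(12 * (((L - (i + 1) : ℕ) : ℝ) + 1) ^ 2)) ≤ 1 :=
        Real.exp_le_one_iff.mpr (by nlinarith [sq_nonneg (((L - (i + 1) : ℕ) : ℝ) + 1)])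
      have h2 : (2 : ℝ) ≤ Real.exp 1 := by linarith [Real.add_one_le_exp (1 : ℝ)]
      have h3 : (((L - (i + 1) : ℕ) : ℝ) + 1) ^ 2 ≤ ((L : ℝ) + 1) ^ 2 := by
        gcongr
        omega
      calc _ ≤ Real.exp (((L : ℝ) + 1) ^ 2) * (Real.exp 1 * B) := by
            gcongr
            nlinarith
        _ = _ := by
            rw [hB, ← Real.exp_add, ← Real.exp_add]
            push_cast
            congr 1
            ring
  have := key L le_rfl n R hR hL
  rw [Nat.sub_self] at this
  refine this.trans (Real.exp_le_exp.mpr ?_)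
  have hL0 : (0 : ℝ) ≤ L := Nat.cast_nonneg _
  nlinarith [pow_nonneg hL0 2, pow_nonneg hL0 3]

end estimate

end SamplingAlg

/-! ### The approximation algorithm -/

namespace SamplingAlg

variable {U : Type} {F : Set (Finset U)}

/-- The failure probability allowed on level `j` of the recursion. It is so small that the expected
cost of a failure is dominated by the cost of the level. -/
noncomputable def levelFailure (j : ℕ) : ℝ := Real.exp (-(12 * ((j : ℝ) + 1) ^ 2))

/-- The number of samples for the empirical frequency on level `j`. The relative variances
of the frequencies then have a sum of order `ε ^ 2`. -/
noncomputable def frequencySamples (c ε : ℝ) (j : ℕ) : ℕ :=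
  ⌈96 * ((j : ℝ) + 1) ^ 2 / (c * ε ^ 2)⌉₊

/-- The estimate for the size of the hidden set. If the recursion reports `0`, so that the
hidden set is found to be empty, the estimate is `0⁻¹ = 0`. -/
noncomputable def sizeEstimate [Fintype U] (huniv : Finset.univ ∈ F)
    (find : ℕ → ∀ R, R ∈ F → SamplingAlg F (Finset U)) (c ε : ℝ) : SamplingAlg F ℝ :=
  (estimate find (fun j => j + 5 + 1) (frequencySamples c ε) (Fintype.card U + 1) 0
    Finset.univ huniv).bind fun X => .done X⁻¹

theorem hits_univ [Fintype U] (S : Finset U) : hits S Finset.univ = S := by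
  ext x
  simp [mem_hits]

/-- The failure probabilities of the tests and searches from level `j` on have a sum of at most
`(1 / 2) ^ (j + 3)`. -/
theorem levelFailure_add_le (j : ℕ) :
    (1 / 2) ^ (j + 5) + levelFailure j + (1 / 2 : ℝ) ^ (j + 1 + 3) ≤ (1 / 2) ^ (j + 3) := by
  have h1 : levelFailure j ≤ (1 / 2) ^ (j + 5) := by
    have h2 : Real.exp (-1) ≤ 1 / 2 := by
      rw [Real.exp_neg, ← one_div]
      exact one_div_le_one_div_of_le (by norm_num) (by linarith [Real.add_one_le_exp (1 : ℝ)])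
    calc levelFailure j ≤ Real.exp ((j + 5 : ℕ) * (-1)) := by
          apply Real.exp_le_exp.mpr
          push_cast
          nlinarith [(Nat.cast_nonneg j : (0 : ℝ) ≤ j)]
      _ = Real.exp (-1) ^ (j + 5) := Real.exp_nat_mul _ _
      _ ≤ _ := by gcongr
  simp only [pow_succ] at h1 ⊢
  linarith

/-- The relative second moment of the product of the frequencies from level `j` on is at most
`exp (2 v / (j + 1))`, where `v = ε ^ 2 / 96`. -/
theorem relativeVariance_mul_le {c ε : ℝ} (hc : 0 < c) (hε : 0 < ε) (j : ℕ) :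
    (1 + 1 / (c * frequencySamples c ε j))
        * Real.exp (2 * (ε ^ 2 / 96) / (((j + 1 : ℕ) : ℝ) + 1))
      ≤ Real.exp (2 * (ε ^ 2 / 96) / ((j : ℝ) + 1)) := by
  set v : ℝ := ε ^ 2 / 96 with hv
  have hN : 1 / (c * frequencySamples c ε j) ≤ v / ((j : ℝ) + 1) ^ 2 := by
    have h1 : 96 * ((j : ℝ) + 1) ^ 2 / (c * ε ^ 2) ≤ frequencySamples c ε j := Nat.le_ceil _
    calc 1 / (c * frequencySamples c ε j)
        ≤ 1 / (c * (96 * ((j : ℝ) + 1) ^ 2 / (c * ε ^ 2))) := by gcongr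
      _ = _ := by
        rw [hv]
        field_simp
  calc _ ≤ Real.exp (v / ((j : ℝ) + 1) ^ 2) * Real.exp (2 * v / (((j + 1 : ℕ) : ℝ) + 1)) := by
        gcongr
        linarith [Real.add_one_le_exp (v / ((j : ℝ) + 1) ^ 2)]
    _ ≤ _ := by
        rw [← Real.exp_add]
        apply Real.exp_le_exp.mpr
        push_cast
        -- The sum of `1 / (j + 1) ^ 2` is compared with a telescoping sum.
        have h1 : 2 * v / ((j : ℝ) + 1) - (v / ((j : ℝ) + 1) ^ 2 + 2 * v / ((j : ℝ) + 1 + 1))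
            = v * j / (((j : ℝ) + 1) ^ 2 * (j + 1 + 1)) := by
          field_simp
          ring
        have h2 : 0 ≤ v * j / (((j : ℝ) + 1) ^ 2 * (j + 1 + 1)) := by positivity
        linarith

theorem failure_bound_le_third {ε : ℝ} (hε : 0 < ε) (hε1 : ε ≤ 1) :
    (1 / 2 : ℝ) ^ (0 + 3) + (Real.exp (2 * (ε ^ 2 / 96) / (((0 : ℕ) : ℝ) + 1)) * 1 ^ 2
      - 2 * 1 + 1) / (ε / 2) ^ 2 ≤ 1 / 3 := by
  have h1 : 2 * (ε ^ 2 / 96) / (((0 : ℕ) : ℝ) + 1) = ε ^ 2 / 48 := by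
    push_cast
    ring
  have h2 : ε ^ 2 ≤ 1 := by nlinarith
  have h3 : Real.exp (ε ^ 2 / 48) ≤ 1 + ε ^ 2 / 24 := by
    have h4 := (abs_le.mp (Real.abs_exp_sub_one_sub_id_le (x := ε ^ 2 / 48)
      (by rw [abs_of_nonneg (by positivity)]; linarith))).2
    nlinarith [sq_nonneg ε]
  have h5 : (Real.exp (ε ^ 2 / 48) * 1 ^ 2 - 2 * 1 + 1) / (ε / 2) ^ 2 ≤ 1 / 6 := by
    rw [div_le_iff₀ (by positivity)]
    linarith
  rw [h1]
  linarith

theorem inv_mem_of_abs_le {w X ε : ℝ} (hw : 0 < w) (hε : 0 < ε) (hε1 : ε ≤ 1)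
    (h : |1 * w * X - 1| ≤ ε / 2) : 1 / (1 + ε) * w ≤ X⁻¹ ∧ X⁻¹ ≤ (1 + ε) * w := by
  obtain ⟨h1, h2⟩ := abs_le.mp h
  rw [one_mul] at h1 h2
  have hX : 0 < X := by
    by_contra hX
    nlinarith
  constructor
  · rw [one_div_mul_eq_div, div_le_iff₀ (by positivity), inv_mul_eq_div, le_div_iff₀ hX]
    linarith
  · rw [inv_le_iff_one_le_mul₀ hX]
    nlinarith

theorem isSetSizeApprox_sizeEstimate [Fintype U] (huniv : Finset.univ ∈ F)
    {find : ℕ → ∀ R, R ∈ F → SamplingAlg F (Finset U)} {c : ℝ} (hc : 0 < c)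
    (hfind : ∀ S j R hR, 2 ≤ (hits S R).card → (find j R hR).expect S
      (open Classical in fun Q _ => if IsBalancedPart F c S R Q then 0 else 1) ≤ levelFailure j) :
    IsSetSizeApprox (sizeEstimate huniv find c) := by
  classical
  intro ε hε hε1 S
  rw [probOf_not, sizeEstimate, expect_bind]
  simp only [expect]
  have hthird : ∀ y : ℝ, y ≤ 1 / 3 → 2 / 3 ≤ 1 - y := fun y hy => by linarith
  apply hthird
  rcases S.eq_empty_or_nonempty with rfl | hS
  · simp only [estimate, expect_bind]
    refine ((expect_draw_mono (g := fun _ _ => 0) fun l hl hl' => ?_).trans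
      (expect_const _ _ _).le).trans (by norm_num)
    rw [if_pos (none_mem_of_isAnswer (by simp [hits_univ]) (by rintro rfl; simp at hl) hl')]
    simp [expect]
  · have hw : (0 : ℝ) < S.card := by exact_mod_cast hS.card_pos
    have herr := expect_estimate_error (S := S) (t := fun j => j + 5) (N := frequencySamples c ε)
      hc (hfind S) (fun j => (Real.exp_pos _).le) (D := fun j => (1 / 2) ^ (j + 3))
      (V := fun j => Real.exp (2 * (ε ^ 2 / 96) / ((j : ℝ) + 1))) (η := ε / 2) (by positivity)
      (fun j => Nat.ceil_pos.mpr (by positivity)) (fun j => by positivity) levelFailure_add_le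
      (fun j => Real.one_le_exp (by positivity)) (relativeVariance_mul_le hc hε)
      (Fintype.card U + 1) 0 Finset.univ huniv (by rwa [hits_univ])
      (by rw [Finset.card_univ]; omega) 1
    rw [hits_univ] at herr
    refine (expect_mono fun X _ => ?_).trans (herr.trans (failure_bound_le_third hε hε1))
    by_cases h : ε / 2 < |1 * (S.card : ℝ) * X - 1|
    · rw [if_pos h]
      split_ifs <;> norm_num
    · rw [if_neg h, if_pos (inv_mem_of_abs_le hw hε hε1 (not_lt.mp h))]

/-- The bound on the number of samples on level `j` consists of the samples for the test of size, for
the search and for the empirical frequency. It is at most `(j + 1) ^ 2 / θ`, where `θ` is the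
first factor of the statement. -/
theorem level_cost_le {c ε C₀ : ℝ} (hc : 0 < c) (hC₀ : 0 ≤ C₀) (hε : 0 < ε) (hε1 : ε ≤ 1) (j : ℕ) :
    ε ^ 2 / (6 + 13 * C₀ + (96 / c + 1)) *
        ((j + 5 + 1 : ℕ) + 13 * C₀ * ((j : ℝ) + 1) ^ 2 + frequencySamples c ε j)
      ≤ ((j : ℝ) + 1) ^ 2 := by
  have hj : (0 : ℝ) ≤ j := Nat.cast_nonneg j
  have hsq : (1 : ℝ) ≤ ((j : ℝ) + 1) ^ 2 := by nlinarith
  have hε2 : ε ^ 2 ≤ 1 := by nlinarith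
  have h1 : ε ^ 2 * ((j + 5 + 1 : ℕ) : ℝ) ≤ 6 * ((j : ℝ) + 1) ^ 2 := by
    calc ε ^ 2 * ((j + 5 + 1 : ℕ) : ℝ) ≤ 1 * ((j + 5 + 1 : ℕ) : ℝ) := by gcongr
      _ ≤ _ := by
        push_cast
        nlinarith
  have h2 : ε ^ 2 * (13 * C₀ * ((j : ℝ) + 1) ^ 2) ≤ 13 * C₀ * ((j : ℝ) + 1) ^ 2 :=
    mul_le_of_le_one_left (by positivity) hε2
  have h3 : ε ^ 2 * frequencySamples c ε j ≤ (96 / c + 1) * ((j : ℝ) + 1) ^ 2 := by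
    have h4 : (frequencySamples c ε j : ℝ) ≤ 96 * ((j : ℝ) + 1) ^ 2 / (c * ε ^ 2) + 1 :=
      (Nat.ceil_lt_add_one (by positivity)).le
    calc ε ^ 2 * frequencySamples c ε j
        ≤ ε ^ 2 * (96 * ((j : ℝ) + 1) ^ 2 / (c * ε ^ 2) + 1) := by gcongr
      _ = 96 / c * ((j : ℝ) + 1) ^ 2 + ε ^ 2 := by field_simp
      _ ≤ _ := by linarith
  rw [div_mul_eq_mul_div, div_le_iff₀ (by positivity)]
  linarith

/-- The exponential moment bound for a recursion of depth `L = O(log w)`, compared with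
`polylogBound`. -/
theorem cube_add_le_polylogBound {M B ε : ℝ} (hM : 0 < M) (hB : 0 < B) (hε : 0 < ε) (w L m : ℕ)
    (hm : 1 ≤ m) (hL : (L : ℝ) + 1 ≤ B * Real.log ((w : ℝ) + 2)) :
    10 * ((L : ℝ) + 1) ^ 3 + m
      ≤ ε ^ 2 / M * (m * (2 * M * (20 * B ^ 3 + 16) * polylogBound w ε)) := by
  have hw : (0 : ℝ) ≤ w := Nat.cast_nonneg w
  have hm1 : (1 : ℝ) ≤ m := by exact_mod_cast hm
  have hlog2 : (1 : ℝ) / 2 ≤ Real.log 2 := by linarith [Real.log_two_gt_d9]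
  rw [polylogBound]
  set lam : ℝ := Real.log ((w : ℝ) + 2) with hlam
  have hlam2 : 1 / 2 ≤ lam := hlog2.trans (Real.log_le_log (by norm_num) (by linarith))
  have hlam0 : 0 < lam := by linarith
  set y : ℝ := Real.log (lam + 2)
  have hy : 1 / 2 ≤ y := hlog2.trans (Real.log_le_log (by norm_num) (by linarith))
  have h1 : ε ^ 2 / M * (m * (2 * M * (20 * B ^ 3 + 16) * (lam ^ 4 * y / ε ^ 2)))
      = m * ((20 * B ^ 3 + 16) * lam ^ 4 * (2 * y)) := by
    field_simp
  have h2 : ((L : ℝ) + 1) ^ 3 ≤ (B * lam) ^ 3 := by gcongr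
  have h3 : B ^ 3 * lam ^ 3 * 1 ≤ B ^ 3 * lam ^ 3 * (2 * lam) := by
    gcongr
    linarith
  have h4 : (1 / 2 : ℝ) ^ 4 ≤ lam ^ 4 := by gcongr
  have h5 : (20 * B ^ 3 + 16) * lam ^ 4 * 1 ≤ (20 * B ^ 3 + 16) * lam ^ 4 * (2 * y) := by
    gcongr
    linarith
  have h6 : (B * lam) ^ 3 = B ^ 3 * lam ^ 3 := by ring
  have h7 : B ^ 3 * lam ^ 3 * (2 * lam) = 2 * (B ^ 3 * lam ^ 4) := by ring
  have h8 : 10 * ((L : ℝ) + 1) ^ 3 + 1 ≤ (20 * B ^ 3 + 16) * lam ^ 4 * (2 * y) := by linarith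
  have h9 : 0 ≤ 10 * ((L : ℝ) + 1) ^ 3 := by positivity
  rw [h1]
  calc 10 * ((L : ℝ) + 1) ^ 3 + m ≤ m * (10 * ((L : ℝ) + 1) ^ 3 + 1) := by nlinarith
    _ ≤ _ := by gcongr

theorem usesSamples_sizeEstimate [Fintype U] (huniv : Finset.univ ∈ F)
    {find : ℕ → ∀ R, R ∈ F → SamplingAlg F (Finset U)} {c C₀ : ℝ} (hc : 0 < c) (hc1 : c < 1)
    (hC₀ : 0 ≤ C₀)
    (hfind : ∀ S j R hR, 2 ≤ (hits S R).card → (find j R hR).expect S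
      (open Classical in fun Q _ => if IsBalancedPart F c S R Q then 0 else 1) ≤ levelFailure j)
    (hK : ∀ S j R hR, ∀ x ∈ ((find j R hR).run S).support,
      (x.2 : ℝ) ≤ 13 * C₀ * ((j : ℝ) + 1) ^ 2) :
    UsesSamples (sizeEstimate huniv find c) (fun w ε => 2 * (6 + 13 * C₀ + (96 / c + 1)) *
      (20 * (1 / Real.log (1 - c)⁻¹ + 4) ^ 3 + 16) * polylogBound w ε) := by
  classical
  intro ε hε hε1 S m
  rcases Nat.eq_zero_or_pos m with rfl | hm
  · rw [probOf_run, Nat.cast_zero, neg_zero, Real.exp_zero]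
    refine (expect_mono (g := fun _ _ => 1) fun X n => ?_).trans (expect_const _ _ _).le
    split_ifs <;> norm_num
  have hρ1 : 1 < (1 - c)⁻¹ := (one_lt_inv₀ (by linarith)).mpr (by linarith)
  set ρ : ℝ := (1 - c)⁻¹
  have hlogρ : 0 < Real.log ρ := Real.log_pos hρ1
  set B : ℝ := 1 / Real.log ρ + 4 with hB
  set M : ℝ := 6 + 13 * C₀ + (96 / c + 1) with hM
  have hM0 : 0 < M := by positivity
  set θ : ℝ := ε ^ 2 / M with hθ
  have hθ0 : 0 < θ := by positivity
  set lam : ℝ := Real.log ((S.card : ℝ) + 2) with hlam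
  have hlam2 : 1 / 2 ≤ lam := by
    have : Real.log 2 ≤ lam :=
      Real.log_le_log (by norm_num) (by linarith [(Nat.cast_nonneg S.card : (0 : ℝ) ≤ _)])
    linarith [Real.log_two_gt_d9]
  set L : ℕ := ⌈lam / Real.log ρ⌉₊ with hL
  have hLB : (L : ℝ) + 1 ≤ B * lam := by
    have h1 := (Nat.ceil_lt_add_one (show 0 ≤ lam / Real.log ρ by positivity)).le
    rw [← hL] at h1
    have h2 : B * lam = lam / Real.log ρ + 4 * lam := by
      rw [hB]
      ring
    linarith
  have hSL : ((hits S Finset.univ).card : ℝ) ≤ ρ ^ L := by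
    rw [hits_univ]
    have h1 : lam ≤ L * Real.log ρ := (div_le_iff₀ hlogρ).mp (Nat.le_ceil _)
    calc (S.card : ℝ) ≤ (S.card : ℝ) + 2 := by linarith
      _ = Real.exp lam := (Real.exp_log (by positivity)).symm
      _ ≤ Real.exp (L * Real.log ρ) := Real.exp_le_exp.mpr h1
      _ = ρ ^ L := by rw [Real.exp_nat_mul, Real.exp_log (by linarith)]
  have hexp := expect_exp_cost_le (S := S) (t := fun j => j + 5) (N := frequencySamples c ε)
    hθ0.le hc1 (hfind S) (fun j => by positivity) (hK S) (level_cost_le hc hC₀ hε hε1)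
    (Fintype.card U + 1) L Finset.univ huniv hSL
  have hθg := cube_add_le_polylogBound hM0 (by positivity : 0 < B) hε S.card L m hm hLB
  set g : ℝ := m * (2 * M * (20 * B ^ 3 + 16) * polylogBound S.card ε)
  rw [probOf_run, sizeEstimate, expect_bind]
  simp only [expect, Nat.add_zero]
  calc _ ≤ (estimate find (fun j => j + 5 + 1) (frequencySamples c ε) (Fintype.card U + 1) 0
        Finset.univ huniv).expect S (fun _ n => Real.exp (-(θ * g)) * Real.exp (θ * n)) := by
        refine expect_mono fun X n => ?_
        rw [← Real.exp_add]
        split_ifs with h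
        · exact Real.one_le_exp (by linarith [mul_le_mul_of_nonneg_left h.le hθ0.le])
        · positivity
    _ ≤ Real.exp (-(θ * g)) * Real.exp (10 * ((L : ℝ) + 1) ^ 3) := by
        rw [expect_mul_left]
        gcongr
    _ ≤ _ := by
        rw [← Real.exp_add]
        exact Real.exp_le_exp.mpr (by linarith)

end SamplingAlg

/-- If balanced parts can be found with logarithmically many samples, then the size of the hidden
set can be approximated with polylogarithmically many samples. -/
theorem exists_setSizeApprox_of_balancedPartsFindable (c C : ℝ) (hc : 0 < c) (hc1 : c < 1) :
    ∃ C' : ℝ, ∀ {U : Type} [Fintype U] (F : Set (Finset U)), Finset.univ ∈ F →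
      BalancedPartsFindable F c C → ∃ A : ℝ → SamplingAlg F ℝ,
        IsSetSizeApprox A ∧ UsesSamples A (fun w ε => C' * polylogBound w ε) := by
  classical
  have hC₀ : 0 ≤ max C 0 := le_max_right _ _
  refine ⟨2 * (6 + 13 * max C 0 + (96 / c + 1)) * (20 * (1 / Real.log (1 - c)⁻¹ + 4) ^ 3 + 16),
    fun {U} _ F huniv hF => ?_⟩
  have hδ0 : ∀ j, 0 < SamplingAlg.levelFailure j := fun j => Real.exp_pos _
  have hδ1 : ∀ j, SamplingAlg.levelFailure j < 1 := fun j =>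
    Real.exp_lt_one_iff.mpr (neg_neg_of_pos (by positivity))
  choose alg halg using fun (j : ℕ) (R : Finset U) (hR : R ∈ F) =>
    hF R hR (SamplingAlg.levelFailure j) (hδ0 j) (hδ1 j)
  let find : ℕ → ∀ R, R ∈ F → SamplingAlg F (Finset U) := fun j R hR =>
    (alg j R hR).weaken (Set.singleton_subset_iff.mpr hR)
  have hfind : ∀ S j R hR, 2 ≤ (hits S R).card → (find j R hR).expect S
      (fun Q _ => if IsBalancedPart F c S R Q then 0 else 1) ≤ SamplingAlg.levelFailure j := by
    intro S j R hR h2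
    have := (halg j R hR S).2 h2
    rw [SamplingAlg.probOf_not] at this
    rw [SamplingAlg.expect_weaken]
    linarith
  refine ⟨SamplingAlg.sizeEstimate huniv find c,
    SamplingAlg.isSetSizeApprox_sizeEstimate huniv hc hfind,
    SamplingAlg.usesSamples_sizeEstimate huniv hc hc1 hC₀ hfind fun S j R hR x hx => ?_⟩
  rw [SamplingAlg.run_weaken] at hx
  have hlog : Real.log (2 / SamplingAlg.levelFailure j) ≤ 13 * ((j : ℝ) + 1) ^ 2 := by
    rw [Real.log_div (by norm_num) (hδ0 j).ne', SamplingAlg.levelFailure, Real.log_exp]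
    nlinarith [Real.log_two_lt_d9, (Nat.cast_nonneg j : (0 : ℝ) ≤ j)]
  calc (x.2 : ℝ) ≤ C * Real.log (2 / SamplingAlg.levelFailure j) := (halg j R hR S).1 x hx
    _ ≤ max C 0 * Real.log (2 / SamplingAlg.levelFailure j) := by
      have := half_le_log_two_div (hδ0 j) (hδ1 j)
      gcongr
      exact le_max_left _ _
    _ ≤ max C 0 * (13 * ((j : ℝ) + 1) ^ 2) := by gcongr
    _ = _ := by ring

theorem mainTheorem7 :
    (∀ d : ℕ, 1 ≤ d →
      (∀ k : ℕ, 1 ≤ k → HasBalancedParts (subgrids d k) (min (1 / 3) (1 / (2 * (d : ℝ))))) ∧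
      (∃ c C : ℝ, 0 < c ∧ ∀ k : ℕ, 1 ≤ k → BalancedPartsFindable (subgrids d k) c C) ∧
      (∃ (C : ℝ) (A : ∀ k : ℕ, ℝ → SamplingAlg (subgrids d k) ℝ), ∀ k : ℕ, 1 ≤ k →
        IsSetSizeApprox (A k) ∧ UsesSamples (A k) (fun w ε => C * polylogBound w ε))) ∧
    ((∀ d : ℕ, HasBalancedParts (subcubes d) (1 / 3)) ∧
      (∃ c C : ℝ, 0 < c ∧ ∀ d : ℕ, BalancedPartsFindable (subcubes d) c C) ∧
      (∃ (C : ℝ) (A : ∀ d : ℕ, ℝ → SamplingAlg (subcubes d) ℝ), ∀ d : ℕ,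
        IsSetSizeApprox (A d) ∧ UsesSamples (A d) (fun w ε => C * polylogBound w ε))) := by
  refine ⟨fun d hd => ?_, hasBalancedParts_subcubes, ?_⟩
  · obtain ⟨c, C, ⟨hc, hc1⟩, hF⟩ := exists_balancedPartsFindable_subgrids hd
    refine ⟨fun k _ => hasBalancedParts_subgrids hd k, ⟨c, C, hc, fun k _ => hF k⟩, ?_⟩
    obtain ⟨C', hC'⟩ := exists_setSizeApprox_of_balancedPartsFindable c C hc hc1
    have hA : ∀ k : ℕ, ∃ A : ℝ → SamplingAlg (subgrids d k) ℝ, 1 ≤ k →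
        IsSetSizeApprox A ∧ UsesSamples A (fun w ε => C' * polylogBound w ε) := by
      intro k
      by_cases hk : 1 ≤ k
      · obtain ⟨A, h⟩ := hC' (subgrids d k) (univ_mem_subgrids hk) (hF k)
        exact ⟨A, fun _ => h⟩
      · exact ⟨fun _ => .done 0, fun h => absurd h hk⟩
    choose A hA using hA
    exact ⟨C', A, hA⟩
  · obtain ⟨c, C, ⟨hc, hc1⟩, hF⟩ := exists_balancedPartsFindable_subcubes
    refine ⟨⟨c, C, hc, hF⟩, ?_⟩
    obtain ⟨C', hC'⟩ := exists_setSizeApprox_of_balancedPartsFindable c C hc hc1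
    choose A hA using fun d => hC' (subcubes d) (univ_mem_subcubes d) (hF d)
    exact ⟨C', A, hA⟩
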